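/- Let $X$ be the position operator on $L^2(\mathbb R)$, $(X\psi)(x)=x\psi(x)$ with $D(X)=\{\psi\in L^2(\mathbb R): x\psi\in L^2(\mathbb R)\}$, and let $D(X^2)=\{\psi\in L^2(\mathbb R): x^2\psi\in L^2(\mathbb R)\}$. For a real-valued $V\in L^\infty(\mathbb R)$ let $H=-\frac{d^2}{dx^2}+V$ be the self-adjoint Schrödinger operator with domain $H^2(\mathbb R)$, let $e^{-itH}$ be the unitary group it generates, and let $X_H(t)=e^{itH}Xe^{-itH}$ with domain $\{\psi\in L^2(\mathbb R): e^{-itH}\psi\in D(X)\}$. Let $R>0$ and $\psi\in H^2(\mathbb R)\cap D(X^2)$. Then there is a constant $\Gamma=\Gamma(R,\psi)$ such that for all real-valued $V_1,V_2\in L^\infty(\mathbb R)$ with $\|V_1\|_\infty\le R$ and $\|V_2\|_\infty\le R$, writing $H_i=-\frac{d^2}{dx^2}+V_i$, and for every $t\in\mathbb R$, the vector $\psi$ lies in the domains of $X_{H_1}(t)$ and $X_{H_2}(t)$, and $$\|X_{H_1}(t)\psi-X_{H_2}(t)\psi\|\le\Gamma\,\bigl(|t|^{1/2}+t^2\bigr)\,\|V_1-V_2\|_\infty^{1/2}.$$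 -/

import Mathlib

open MeasureTheory Topology Filter
open scoped ENNReal SchwartzMap FourierTransform Laplacian

namespace Schrodinger

section Abstract

variable {E : Type*} [NormedAddCommGroup E] [InnerProductSpace ℂ E]

/-- `U` is the strongly continuous one-parameter unitary group `U t = exp (-i t A)`: it satisfies the
group law, it is strongly continuous, and its generator is exactly `-i A`, that is, `t ↦ U t ψ` is
differentiable at `0` with derivative `φ` iff `ψ` lies in the domain of `A` and `φ = -i A ψ`. -/
structure IsUnitaryGroupOf (U : ℝ → E ≃ₗᵢ[ℂ] E) (A : E →ₗ.[ℂ] E) : Prop where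
  map_add : ∀ s t : ℝ, ∀ ψ : E, U (s + t) ψ = U s (U t ψ)
  continuous : ∀ ψ : E, Continuous fun t : ℝ => U t ψ
  hasDerivAt_zero_iff : ∀ ψ φ : E, HasDerivAt (fun t : ℝ => U t ψ) φ 0 ↔
    ∃ h : ψ ∈ A.domain, φ = -(Complex.I • A ⟨ψ, h⟩)

theorem hasDerivAt_zero_iff_tendsto (f : ℝ → E) (φ : E) :
    HasDerivAt f φ 0 ↔
      Tendsto (fun s : ℝ => ((s⁻¹ : ℝ) : ℂ) • (f s - f 0)) (𝓝[≠] 0) (𝓝 φ) := by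
  rw [hasDerivAt_iff_tendsto_slope_zero]
  simp only [zero_add, Complex.coe_smul]

theorem continuous_apply_of_bound {F : Type*} [NormedAddCommGroup F] [NormedSpace ℂ F]
    {G : ℝ → F →L[ℂ] F} {b : ℝ}
    (hG : ∀ x, Continuous fun s => G s x) (hb : ∀ s x, ‖G s x‖ ≤ b * ‖x‖)
    {f : ℝ → F} (hf : Continuous f) : Continuous fun s => G s (f s) := by
  rw [continuous_iff_continuousAt]
  intro s₀
  have h1 : Tendsto (fun s => G s (f s - f s₀)) (𝓝 s₀) (𝓝 0) := by
    refine squeeze_zero_norm (fun s => hb s _) ?_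
    have : Tendsto (fun s => b * ‖f s - f s₀‖) (𝓝 s₀) (𝓝 (b * ‖f s₀ - f s₀‖)) :=
      ((hf.sub continuous_const).norm.const_mul b).tendsto s₀
    simpa using this
  have h2 := h1.add ((hG (f s₀)).tendsto s₀)
  simpa [ContinuousAt] using h2

/-- Terms of the Dyson series of the linear equation `y' = G t y`, `y 0 = x`. -/
noncomputable def dysonTerm {F : Type*} [NormedAddCommGroup F] [NormedSpace ℂ F]
    (G : ℝ → F →L[ℂ] F) (x : F) : ℕ → ℝ → F
  | 0 => fun _ => x
  | n + 1 => fun t => ∫ s in (0 : ℝ)..t, G s (dysonTerm G x n s)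

/-- Global solvability of a linear equation with strongly continuous bounded coefficients. -/
theorem exists_linear_ode {F : Type*} [NormedAddCommGroup F] [NormedSpace ℂ F] [CompleteSpace F]
    {G : ℝ → F →L[ℂ] F} {b : ℝ} (hb0 : 0 ≤ b)
    (hG : ∀ x, Continuous fun s => G s x) (hb : ∀ s x, ‖G s x‖ ≤ b * ‖x‖) (x : F) :
    ∃ y : ℝ → F, y 0 = x ∧ ∀ t, HasDerivAt y (G t (y t)) t := by
  have hc : ∀ n, Continuous (dysonTerm G x n) := by
    intro n
    induction n with
    | zero => exact continuous_const
    | succ n ih =>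
      exact intervalIntegral.continuous_primitive
        (fun a c => (continuous_apply_of_bound hG hb ih).intervalIntegrable a c) 0
  have hd : ∀ n t, HasDerivAt (dysonTerm G x (n + 1)) (G t (dysonTerm G x n t)) t := fun n t =>
    intervalIntegral.integral_hasDerivAt_right
      ((continuous_apply_of_bound hG hb (hc n)).intervalIntegrable _ _)
      ((continuous_apply_of_bound hG hb (hc n)).stronglyMeasurableAtFilter _ _)
      (continuous_apply_of_bound hG hb (hc n)).continuousAt
  have hn : ∀ n t, ‖dysonTerm G x n t‖ ≤ (b * |t|) ^ n / n.factorial * ‖x‖ := by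
    intro n
    induction n with
    | zero => intro t; simp [dysonTerm]
    | succ n ih =>
      intro t
      have key : ‖∫ s in (0 : ℝ)..t, G s (dysonTerm G x n s)‖ ≤
          |∫ s in (0 : ℝ)..t, (b ^ (n + 1) / n.factorial * ‖x‖) * |s - 0| ^ n| := by
        refine intervalIntegral.norm_integral_le_abs_of_norm_le ?_ ?_
        · filter_upwards with s
          refine (hb s _).trans ?_
          refine (mul_le_mul_of_nonneg_left (ih s) hb0).trans (le_of_eq ?_)
          rw [sub_zero, mul_pow]; ring
        · exact Continuous.intervalIntegrable (by fun_prop) _ _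
      refine key.trans (le_of_eq ?_)
      rw [intervalIntegral.integral_const_mul, abs_mul, intervalIntegral.abs_intervalIntegral_eq,
        integral_pow_abs_sub_uIoc, abs_of_nonneg (by positivity : 0 ≤ b ^ (n + 1) / n.factorial * ‖x‖),
        abs_of_nonneg (by positivity), sub_zero, Nat.factorial_succ]
      push_cast
      rw [mul_pow]
      field_simp
  have hs : ∀ t, Summable fun n => dysonTerm G x n t := fun t =>
    Summable.of_norm_bounded ((Real.summable_pow_div_factorial (b * |t|)).mul_right ‖x‖)
      fun n => hn n t
  refine ⟨fun t => ∑' n, dysonTerm G x n t, ?_, ?_⟩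
  · change ∑' n, dysonTerm G x n 0 = x
    rw [tsum_eq_single 0]
    · rfl
    · intro n hn0
      obtain ⟨m, rfl⟩ := Nat.exists_eq_succ_of_ne_zero hn0
      simp [dysonTerm]
  · intro t
    set T := |t| + 1
    have hT0 : 0 ≤ T := by positivity
    let g' : ℕ → ℝ → F := fun n s => match n with
      | 0 => 0
      | m + 1 => G s (dysonTerm G x m s)
    let u : ℕ → ℝ := fun n => match n with
      | 0 => 0
      | m + 1 => b * ((b * T) ^ m / m.factorial * ‖x‖)
    have hu : Summable u := by
      rw [← summable_nat_add_iff 1]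
      exact ((Real.summable_pow_div_factorial (b * T)).mul_right ‖x‖).mul_left b
    have h := hasDerivAt_tsum_of_isPreconnected (𝕜 := ℝ) (g := dysonTerm G x) (g' := g') (y₀ := 0)
      (y := t) hu Metric.isOpen_ball (convex_ball (0 : ℝ) T).isPreconnected ?_ ?_ ?_ (hs 0) ?_
    · convert h using 1
      have hs' : Summable fun n => g' n t := by
        rw [← summable_nat_add_iff 1]
        exact (hs t).mapL (G t)
      rw [hs'.tsum_eq_zero_add, (G t).map_tsum (hs t)]
      simp [g']
    · intro n s _
      match n with
      | 0 => exact hasDerivAt_const _ _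
      | m + 1 => exact hd m s
    · intro n s hs
      have hs : |s| ≤ T := by simpa using (mem_ball_zero_iff.1 hs).le
      match n with
      | 0 => simp [g', u]
      | m + 1 =>
        refine (hb s _).trans (mul_le_mul_of_nonneg_left ((hn m s).trans ?_) hb0)
        gcongr
    · simp [T]; positivity
    · simp [T]

namespace IsUnitaryGroupOf

variable {U : ℝ → E ≃ₗᵢ[ℂ] E} {A : E →ₗ.[ℂ] E}

theorem map_zero_apply (hU : IsUnitaryGroupOf U A) (x : E) : U 0 x = x := by
  apply (U 0).injective
  rw [← hU.map_add, add_zero]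

theorem apply_neg_apply (hU : IsUnitaryGroupOf U A) (t : ℝ) (x : E) : U t (U (-t) x) = x := by
  rw [← hU.map_add, add_neg_cancel, hU.map_zero_apply]

theorem neg_apply_apply (hU : IsUnitaryGroupOf U A) (t : ℝ) (x : E) : U (-t) (U t x) = x := by
  rw [← hU.map_add, neg_add_cancel, hU.map_zero_apply]

theorem hasDerivAt (hU : IsUnitaryGroupOf U A) (ψ : A.domain) (t : ℝ) :
    HasDerivAt (fun s => U s (ψ : E)) (U t (-(Complex.I • A ψ))) t := by
  have h0 := (hU.hasDerivAt_zero_iff ψ _).2 ⟨ψ.2, rfl⟩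
  have h1 : HasDerivAt (fun s => U (s - t) (ψ : E)) (-(Complex.I • A ψ)) t :=
    HasDerivAt.comp_sub_const t t (by rwa [sub_self])
  have h2 := ((((U t : E ≃L[ℂ] E) : E →L[ℂ] E).restrictScalars ℝ).hasFDerivAt).comp_hasDerivAt t h1
  refine h2.congr_of_eventuallyEq (Eventually.of_forall fun s => ?_)
  change U s (ψ : E) = U t (U (s - t) ψ)
  rw [← hU.map_add, add_sub_cancel]

theorem apply_mem_domain (hU : IsUnitaryGroupOf U A) (ψ : A.domain) (t : ℝ) :
    ∃ h : U t (ψ : E) ∈ A.domain, U t (-(Complex.I • A ψ)) = -(Complex.I • A ⟨U t ψ, h⟩) := by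
  rw [← hU.hasDerivAt_zero_iff]
  have h := HasDerivAt.comp_add_const (f := fun s => U s (ψ : E)) 0 t
    (by rw [zero_add]; exact hU.hasDerivAt ψ t)
  simpa only [hU.map_add] using h

theorem inner_add_inner_eq_zero (hU : IsUnitaryGroupOf U A) (ψ : A.domain) :
    inner ℂ (ψ : E) (-(Complex.I • A ψ)) + inner ℂ (-(Complex.I • A ψ)) (ψ : E) = 0 := by
  have h := (hU.hasDerivAt ψ 0).inner ℂ (hU.hasDerivAt ψ 0)
  simp only [LinearIsometryEquiv.inner_map_map] at h
  exact h.unique (hasDerivAt_const _ _)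

/-- A densely defined operator generates at most one unitary group. -/
theorem unique {W : ℝ → E ≃ₗᵢ[ℂ] E} (hA : Dense (A.domain : Set E)) (hU : IsUnitaryGroupOf U A)
    (hW : IsUnitaryGroupOf W A) : U = W := by
  have key : ∀ (ψ : A.domain) t, U t (ψ : E) = W t (ψ : E) := by
    intro ψ
    let w : ℝ → E := fun t => U t (ψ : E) - W t (ψ : E)
    have hd : ∀ t, HasDerivAt (fun t => inner ℂ (w t) (w t)) 0 t := by
      intro t
      obtain ⟨h1, e1⟩ := hU.apply_mem_domain ψ t
      obtain ⟨h2, e2⟩ := hW.apply_mem_domain ψ t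
      have h : HasDerivAt w (-(Complex.I • A (⟨U t ψ, h1⟩ - ⟨W t ψ, h2⟩))) t := by
        convert (hU.hasDerivAt ψ t).sub (hW.hasDerivAt ψ t) using 1
        · rfl
        · rw [e1, e2, LinearPMap.map_sub, smul_sub]
          abel
      have h' := h.inner ℂ h
      rwa [show w t = ((⟨U t ψ, h1⟩ - ⟨W t ψ, h2⟩ : A.domain) : E) from rfl,
        hU.inner_add_inner_eq_zero] at h'
    intro t
    have h := is_const_of_deriv_eq_zero (fun t => (hd t).differentiableAt)
      (fun t => (hd t).deriv) t 0
    simpa [w, hU.map_zero_apply, hW.map_zero_apply, sub_eq_zero] using h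
  ext t x
  refine congrFun (Continuous.ext_on hA (U t).continuous (W t).continuous fun y hy => ?_) x
  exact key ⟨y, hy⟩ t

end IsUnitaryGroupOf

theorem norm_eq_of_skew_ode {G : ℝ → E →L[ℂ] E}
    (hskew : ∀ t x, inner ℂ x (G t x) + inner ℂ (G t x) x = 0)
    {y : ℝ → E} (hy : ∀ t, HasDerivAt y (G t (y t)) t) (t : ℝ) : ‖y t‖ = ‖y 0‖ := by
  have hd : ∀ t, HasDerivAt (fun t => inner ℂ (y t) (y t)) 0 t := fun t => by
    have := (hy t).inner ℂ (hy t)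
    rwa [hskew] at this
  have h := is_const_of_deriv_eq_zero (fun t => (hd t).differentiableAt) (fun t => (hd t).deriv) t 0
  simp only [inner_self_eq_norm_sq_to_K] at h
  have h' : ‖y t‖ ^ 2 = ‖y 0‖ ^ 2 := by exact_mod_cast h
  exact (sq_eq_sq₀ (norm_nonneg _) (norm_nonneg _)).1 h'

theorem eq_of_skew_ode {G : ℝ → E →L[ℂ] E}
    (hskew : ∀ t x, inner ℂ x (G t x) + inner ℂ (G t x) x = 0)
    {y z : ℝ → E} (hy : ∀ t, HasDerivAt y (G t (y t)) t) (hz : ∀ t, HasDerivAt z (G t (z t)) t)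
    (h0 : y 0 = z 0) (t : ℝ) : y t = z t := by
  have h := norm_eq_of_skew_ode hskew (y := fun t => y t - z t)
    (fun t => by simp only [map_sub]; exact (hy t).sub (hz t)) t
  simpa [h0, sub_eq_zero] using h

/-- A bounded symmetric perturbation of the generator of a unitary group generates a unitary
group. -/
theorem exists_isUnitaryGroupOf_vadd [CompleteSpace E] {U : ℝ → E ≃ₗᵢ[ℂ] E} {A : E →ₗ.[ℂ] E}
    (hU : IsUnitaryGroupOf U A) (B : E →L[ℂ] E) (hB : ∀ x y, inner ℂ (B x) y = inner ℂ x (B y)) :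
    ∃ W : ℝ → E ≃ₗᵢ[ℂ] E, IsUnitaryGroupOf W ((B : E →ₗ[ℂ] E) +ᵥ A) := by
  let u : ℝ → E →L[ℂ] E := fun t => ((U t : E ≃L[ℂ] E) : E →L[ℂ] E)
  have hu : ∀ t x, u t x = U t x := fun _ _ => rfl
  have huc : ∀ f : ℝ → E, Continuous f → Continuous fun t => U t (f t) := fun f hf =>
    continuous_apply_of_bound (G := u) (b := 1) hU.continuous (fun s x => by simp [hu]) hf
  have huc' : ∀ f : ℝ → E, Continuous f → Continuous fun t => U (-t) (f t) := fun f hf =>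
    continuous_apply_of_bound (G := fun t => u (-t)) (b := 1)
      (fun x => (hU.continuous x).comp continuous_neg) (fun s x => by simp [hu]) hf
  let G : ℝ → E →L[ℂ] E := fun t => (-Complex.I) • (u (-t) ∘L B ∘L u t)
  have hGa : ∀ t x, G t x = -(Complex.I • U (-t) (B (U t x))) := fun t x => by simp [G, hu]
  have hGc : ∀ x, Continuous fun s => G s x := fun x => by
    simp only [hGa]
    exact ((huc' _ (B.continuous.comp (hU.continuous x))).const_smul Complex.I).neg
  have hGb : ∀ s x, ‖G s x‖ ≤ ‖B‖ * ‖x‖ := fun s x => by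
    rw [hGa, norm_neg, norm_smul, Complex.norm_I, one_mul, LinearIsometryEquiv.norm_map]
    exact (B.le_opNorm _).trans_eq (by rw [LinearIsometryEquiv.norm_map])
  have hadj : ∀ t x y, inner ℂ x (U (-t) y) = inner ℂ (U t x) y := fun t x y => by
    rw [← (U t).inner_map_map, hU.apply_neg_apply]
  have hskew : ∀ t x, inner ℂ x (G t x) + inner ℂ (G t x) x = 0 := fun t x => by
    have h1 : inner ℂ (U (-t) (B (U t x))) x = inner ℂ x (U (-t) (B (U t x))) := by
      rw [hadj, ← hB, ← inner_conj_symm, hadj, inner_conj_symm]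
    rw [hGa, inner_neg_right, inner_neg_left, inner_smul_right, inner_smul_left, h1]
    simp
  choose y hy0 hy using fun x => exists_linear_ode (norm_nonneg B) hGc hGb x
  have hyadd : ∀ x z t, y (x + z) t = y x t + y z t := fun x z =>
    eq_of_skew_ode hskew (hy _) (fun t => by simp only [_root_.map_add]; exact (hy x t).add (hy z t)) (by simp [hy0])
  have hysmul : ∀ (c : ℂ) x t, y (c • x) t = c • y x t := fun c x =>
    eq_of_skew_ode hskew (hy _) (fun t => by simp only [map_smul]; exact (hy x t).const_smul c) (by simp [hy0])
  have hynorm : ∀ x t, ‖y x t‖ = ‖x‖ := fun x t => by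
    rw [norm_eq_of_skew_ode hskew (hy x) t, hy0]
  have hyc : ∀ x, Continuous (y x) := fun x =>
    continuous_iff_continuousAt.2 fun t => (hy x t).continuousAt
  have hgroup : ∀ s t x, U (s + t) (y x (s + t)) = U s (y (U t (y x t)) s) := by
    intro s t x
    have key : ∀ s, U t (y x (s + t)) = y (U t (y x t)) s := by
      refine eq_of_skew_ode hskew (fun s => ?_) (hy _) (by simp [hy0])
      have h1 : HasDerivAt (fun s => U t (y x (s + t))) (U t (G (s + t) (y x (s + t)))) s :=
        ((u t).restrictScalars ℝ).hasFDerivAt.comp_hasDerivAt s ((hy x (s + t)).comp_add_const s t)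
      convert h1 using 1
      rw [hGa, hGa, map_neg, map_smul, ← hU.map_add, ← hU.map_add]
      congr 4
      ring
    rw [← key s, hU.map_add]
  have hzero : ∀ x, U 0 (y x 0) = x := fun x => by rw [hy0, hU.map_zero_apply]
  let W : ℝ → E ≃ₗᵢ[ℂ] E := fun t =>
    { toFun := fun x => U t (y x t)
      map_add' := fun x z => by rw [hyadd, _root_.map_add]
      map_smul' := fun c x => by rw [hysmul, map_smul]; rfl
      invFun := fun x => U (-t) (y x (-t))
      left_inv := fun x => by
        have := hgroup (-t) t x
        rw [neg_add_cancel, hzero] at this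
        exact this.symm
      right_inv := fun x => by
        have := hgroup t (-t) x
        rw [add_neg_cancel, hzero] at this
        exact this.symm
      norm_map' := fun x => by
        change ‖U t (y x t)‖ = ‖x‖
        rw [LinearIsometryEquiv.norm_map, hynorm] }
  have hW : ∀ t x, W t x = U t (y x t) := fun _ _ => rfl
  refine ⟨W, fun s t x => by rw [hW, hW, hW, hgroup], fun x => huc _ (hyc x), fun x φ => ?_⟩
  have hdiff : HasDerivAt (fun t => U t (y x t - x)) (-(Complex.I • B x)) 0 := by
    rw [hasDerivAt_iff_tendsto_slope_zero]
    have h0 := (hasDerivAt_iff_tendsto_slope_zero.1 (hy x 0))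
    rw [hGa, hy0, neg_zero, hU.map_zero_apply, hU.map_zero_apply] at h0
    simp only [zero_add, hy0, sub_self, map_zero, sub_zero] at h0 ⊢
    have h1 : Tendsto (fun t => U t (t⁻¹ • (y x t - x) - -(Complex.I • B x))) (𝓝[≠] (0 : ℝ))
        (𝓝 0) := by
      rw [tendsto_zero_iff_norm_tendsto_zero]
      simp only [LinearIsometryEquiv.norm_map]
      rw [← tendsto_zero_iff_norm_tendsto_zero]
      simpa using h0.sub_const (-(Complex.I • B x))
    have h2 := h1.add (((hU.continuous (-(Complex.I • B x))).tendsto 0).mono_left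
      nhdsWithin_le_nhds)
    rw [hU.map_zero_apply, zero_add] at h2
    refine h2.congr fun t => ?_
    rw [← _root_.map_add, sub_add_cancel]
    exact ((u t).restrictScalars ℝ).map_smul _ _
  have hsum : ∀ t, W t x = U t x + U t (y x t - x) := fun t => by
    rw [← _root_.map_add, add_sub_cancel, hW]
  have hiff : HasDerivAt (fun t => W t x) φ 0 ↔
      HasDerivAt (fun t => U t x) (φ + Complex.I • B x) 0 := by
    constructor
    · intro h
      convert h.sub hdiff using 1
      · ext t; simp [hsum]
      · rw [sub_neg_eq_add]
    · intro h
      convert h.add hdiff using 1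
      · ext t; simp [hsum]
      · simp
  rw [hiff, hU.hasDerivAt_zero_iff]
  constructor
  · rintro ⟨h, e⟩
    refine ⟨h, ?_⟩
    rw [LinearPMap.vadd_apply, smul_add, neg_add_rev, ← e]
    simp
  · rintro ⟨h, e⟩
    refine ⟨h, ?_⟩
    rw [e, LinearPMap.vadd_apply, smul_add, neg_add_rev]
    simp

/-- Transport of a unitary group along a unitary map. -/
theorem exists_isUnitaryGroupOf_conj {U : ℝ → E ≃ₗᵢ[ℂ] E} {A B : E →ₗ.[ℂ] E}
    (hU : IsUnitaryGroupOf U A) (F : E ≃ₗᵢ[ℂ] E)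
    (hF : ∀ ψ φ, (∃ h : ψ ∈ B.domain, B ⟨ψ, h⟩ = φ) ↔
      ∃ h : F ψ ∈ A.domain, A ⟨F ψ, h⟩ = F φ) :
    ∃ W : ℝ → E ≃ₗᵢ[ℂ] E, IsUnitaryGroupOf W B := by
  refine ⟨fun t => (F.trans (U t)).trans F.symm, fun s t ψ => ?_, fun ψ => ?_, fun ψ φ => ?_⟩
  · simp [hU.map_add]
  · exact F.symm.continuous.comp (hU.continuous (F ψ))
  · have h1 : HasDerivAt (fun t : ℝ => ((F.trans (U t)).trans F.symm) ψ) φ 0 ↔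
        HasDerivAt (fun t : ℝ => U t (F ψ)) (F φ) 0 := by
      rw [hasDerivAt_zero_iff_tendsto, hasDerivAt_zero_iff_tendsto]
      simp only [LinearIsometryEquiv.trans_apply, ← map_sub, ← map_smul]
      constructor
      · intro h
        have := (F.continuous.tendsto φ).comp h
        simpa [Function.comp_def] using this
      · intro h
        have := (F.symm.continuous.tendsto (F φ)).comp h
        simpa [Function.comp_def] using this
    have h2 : ∀ (A : E →ₗ.[ℂ] E) (ψ φ : E), (∃ h : ψ ∈ A.domain, φ = -(Complex.I • A ⟨ψ, h⟩)) ↔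
        ∃ h : ψ ∈ A.domain, A ⟨ψ, h⟩ = Complex.I • φ := fun A ψ φ => by
      refine exists_congr fun h => ⟨fun e => ?_, fun e => ?_⟩
      · rw [e, smul_neg, smul_smul, Complex.I_mul_I]; simp
      · rw [e, smul_smul, Complex.I_mul_I]; simp
    rw [h1, hU.hasDerivAt_zero_iff, h2, h2, hF, ← map_smul]

end Abstract

section Concrete

/-- The Hilbert space `L²(ℝ)` of complex-valued functions. -/
abbrev L2 : Type := Lp ℂ 2 (volume : Measure ℝ)

/-- The space `L^∞(ℝ)` of real-valued functions; its norm is the essential supremum. -/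
abbrev LInfty : Type := Lp ℝ ∞ (volume : Measure ℝ)

/-- The maximal operator of multiplication by `g`, with domain `{ψ ∈ L² : g ψ ∈ L²}`. -/
noncomputable def mulOp (g : ℝ → ℝ) : L2 →ₗ.[ℂ] L2 where
  domain :=
    { carrier := {ψ | MemLp (fun x => (g x : ℂ) * ψ x) 2 volume}
      zero_mem' := by
        refine MemLp.ae_eq ?_ (MemLp.zero' : MemLp (fun _ : ℝ => (0 : ℂ)) 2 volume)
        filter_upwards [Lp.coeFn_zero ℂ 2 (volume : Measure ℝ)] with x hx
        simp
      add_mem' := fun {ψ φ} hψ hφ => by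
        refine MemLp.ae_eq ?_ (MemLp.add hψ hφ)
        filter_upwards [Lp.coeFn_add ψ φ] with x hx
        rw [hx, Pi.add_apply, Pi.add_apply, mul_add]
      smul_mem' := fun c ψ hψ => by
        refine MemLp.ae_eq ?_ (MemLp.const_smul hψ c)
        filter_upwards [Lp.coeFn_smul c ψ] with x hx
        simp [hx, mul_left_comm] }
  toFun :=
    { toFun := fun ψ => MemLp.toLp _ ψ.2
      map_add' := fun ψ φ => by
        refine Lp.ext ?_
        filter_upwards [MemLp.coeFn_toLp (ψ + φ).2, MemLp.coeFn_toLp ψ.2, MemLp.coeFn_toLp φ.2,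
          Lp.coeFn_add (MemLp.toLp _ ψ.2) (MemLp.toLp _ φ.2),
          Lp.coeFn_add (ψ : L2) (φ : L2)] with x h1 h2 h3 h4 h5
        rw [h1, h4, Pi.add_apply, h2, h3, ← mul_add, ← Pi.add_apply, ← h5]
        rfl
      map_smul' := fun c ψ => by
        refine Lp.ext ?_
        filter_upwards [MemLp.coeFn_toLp (c • ψ).2, MemLp.coeFn_toLp ψ.2,
          Lp.coeFn_smul c (MemLp.toLp _ ψ.2), Lp.coeFn_smul c (ψ : L2)] with x h1 h2 h3 h4
        rw [h1, RingHom.id_apply, h3, Pi.smul_apply, h2]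
        simp [h4, mul_left_comm] }

theorem coeFn_mulOp (g : ℝ → ℝ) (ψ : (mulOp g).domain) :
    mulOp g ψ =ᵐ[volume] fun x => (g x : ℂ) * (ψ : L2) x :=
  MemLp.coeFn_toLp ψ.2

theorem exists_mulOp_eq_iff (g : ℝ → ℝ) (ψ φ : L2) :
    (∃ h : ψ ∈ (mulOp g).domain, mulOp g ⟨ψ, h⟩ = φ) ↔
      φ =ᵐ[volume] fun x => (g x : ℂ) * ψ x := by
  constructor
  · rintro ⟨h, rfl⟩
    exact coeFn_mulOp g ⟨ψ, h⟩
  · intro h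
    have hm : ψ ∈ (mulOp g).domain := MemLp.ae_eq h (Lp.memLp φ)
    exact ⟨hm, Lp.ext ((coeFn_mulOp g ⟨ψ, hm⟩).trans h.symm)⟩

/-- Dominated convergence in `L²`. -/
theorem tendsto_L2_of_dominated {F : ℕ → L2} {f b : L2} {G : ℕ → ℝ → ℂ} {g : ℝ → ℂ}
    (hF : ∀ n, F n =ᵐ[volume] G n) (hf : f =ᵐ[volume] g)
    (hb : ∀ᵐ x ∂(volume : Measure ℝ), ∀ n, ‖G n x‖ ≤ ‖b x‖)
    (h : ∀ᵐ x ∂(volume : Measure ℝ), Tendsto (fun n => G n x) atTop (𝓝 (g x))) :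
    Tendsto F atTop (𝓝 f) := by
  have h1 : Tendsto (fun n => ∫ x, ((‖F n x - f x‖ ^ 2 : ℝ) : ℂ)) atTop
      (𝓝 (∫ _ : ℝ, (0 : ℂ))) := by
    refine tendsto_integral_of_dominated_convergence (fun x => (2 * ‖b x‖) ^ 2) ?_ ?_ ?_ ?_
    · intro n
      exact Complex.continuous_ofReal.comp_aestronglyMeasurable
        ((((Lp.aestronglyMeasurable (F n)).sub (Lp.aestronglyMeasurable f)).norm).pow 2)
    · simp only [mul_pow]
      exact ((Lp.memLp b).integrable_norm_pow two_ne_zero).const_mul _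
    · intro n
      filter_upwards [hb, hF n, hf, h] with x hbx hFx hfx hx
      have h2 : ‖g x‖ ≤ ‖b x‖ := le_of_tendsto hx.norm (Eventually.of_forall hbx)
      rw [Complex.norm_real, norm_pow, norm_norm, hFx, hfx]
      have := norm_sub_le (G n x) (g x)
      have := hbx n
      gcongr
      linarith
    · filter_upwards [ae_all_iff.2 hF, hf, h] with x hFx hfx hx
      have := ((hx.sub_const (g x)).norm.pow 2)
      have h2 := (Complex.continuous_ofReal.tendsto _).comp this
      simpa [hFx, hfx, Function.comp_def] using h2
  have h2 : ∀ n, ∫ x, ((‖F n x - f x‖ ^ 2 : ℝ) : ℂ) = ((‖F n - f‖ ^ 2 : ℝ) : ℂ) := fun n => by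
    have h3 : ((‖F n - f‖ ^ 2 : ℝ) : ℂ) = inner ℂ (F n - f) (F n - f) := by
      rw [inner_self_eq_norm_sq_to_K]; simp
    rw [h3, L2.inner_def]
    refine integral_congr_ae ?_
    filter_upwards [Lp.coeFn_sub (F n) f] with x hx
    rw [inner_self_eq_norm_sq_to_K, hx]
    simp
  simp only [h2, integral_zero] at h1
  rw [tendsto_iff_norm_sub_tendsto_zero]
  have h3 := (Complex.continuous_re.tendsto _).comp h1
  have h4 := (Real.continuous_sqrt.tendsto _).comp h3
  simpa [Function.comp_def, ← Complex.ofReal_pow] using h4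

theorem memLp_phase (c : ℝ → ℂ) (hc : Measurable c) (h1 : ∀ x, ‖c x‖ = 1) (ψ : L2) :
    MemLp (fun x => c x * ψ x) 2 volume :=
  (Lp.memLp ψ).congr_norm (hc.aestronglyMeasurable.mul (Lp.aestronglyMeasurable ψ))
    (Eventually.of_forall fun x => by simp [h1])

/-- Multiplication by a function of modulus one. -/
noncomputable def phaseMap (c : ℝ → ℂ) (hc : Measurable c) (h1 : ∀ x, ‖c x‖ = 1) : L2 →ₗᵢ[ℂ] L2 :=
  have hm := memLp_phase c hc h1
  { toFun := fun ψ => (hm ψ).toLp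
    map_add' := fun ψ φ => by
      refine Lp.ext ?_
      filter_upwards [MemLp.coeFn_toLp (hm (ψ + φ)), MemLp.coeFn_toLp (hm ψ),
        MemLp.coeFn_toLp (hm φ), Lp.coeFn_add (MemLp.toLp _ (hm ψ)) (MemLp.toLp _ (hm φ)),
        Lp.coeFn_add ψ φ] with x h1 h2 h3 h4 h5
      rw [h1, h4, Pi.add_apply, h2, h3, h5, Pi.add_apply, mul_add]
    map_smul' := fun a ψ => by
      refine Lp.ext ?_
      filter_upwards [MemLp.coeFn_toLp (hm (a • ψ)), MemLp.coeFn_toLp (hm ψ),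
        Lp.coeFn_smul a (MemLp.toLp _ (hm ψ)), Lp.coeFn_smul a ψ] with x h1 h2 h3 h4
      rw [h1, RingHom.id_apply, h3, Pi.smul_apply, h2]
      simp [h4, mul_left_comm]
    norm_map' := fun ψ => by
      change ‖(hm ψ).toLp‖ = ‖ψ‖
      refine le_antisymm (Lp.norm_le_norm_of_ae_le ?_) (Lp.norm_le_norm_of_ae_le ?_) <;>
      · filter_upwards [MemLp.coeFn_toLp (hm ψ)] with x hx
        simp [hx, h1] }

theorem coeFn_phaseMap (c : ℝ → ℂ) (hc : Measurable c) (h1 : ∀ x, ‖c x‖ = 1) (ψ : L2) :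
    phaseMap c hc h1 ψ =ᵐ[volume] fun x => c x * ψ x :=
  MemLp.coeFn_toLp (memLp_phase c hc h1 ψ)

/-- Multiplication by a real measurable function generates a unitary group. -/
theorem exists_isUnitaryGroupOf_mulOp {k : ℝ → ℝ} (hk : Measurable k) :
    ∃ U : ℝ → L2 ≃ₗᵢ[ℂ] L2, IsUnitaryGroupOf U (mulOp k) := by
  let c : ℝ → ℝ → ℂ := fun t x => Complex.exp ((-(t * k x) : ℝ) * Complex.I)
  have hc : ∀ t, Measurable (c t) := fun t => by fun_prop
  have h1 : ∀ t x, ‖c t x‖ = 1 := fun t x => Complex.norm_exp_ofReal_mul_I _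
  have hadd : ∀ s t x, c (s + t) x = c s x * c t x := fun s t x => by
    simp only [c, ← Complex.exp_add]; congr 1; push_cast; ring
  have h0 : ∀ x, c 0 x = 1 := fun x => by simp [c]
  have hgroup : ∀ s t ψ, phaseMap (c (s + t)) (hc _) (h1 _) ψ =
      phaseMap (c s) (hc _) (h1 _) (phaseMap (c t) (hc _) (h1 _) ψ) := fun s t ψ => by
    refine Lp.ext ?_
    filter_upwards [coeFn_phaseMap (c (s + t)) (hc _) (h1 _) ψ, coeFn_phaseMap (c t) (hc _) (h1 _) ψ,
      coeFn_phaseMap (c s) (hc _) (h1 _) (phaseMap (c t) (hc _) (h1 _) ψ)] with x e1 e2 e3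
    rw [e1, e3, e2, hadd, mul_assoc]
  have hid : ∀ ψ, phaseMap (c 0) (hc _) (h1 _) ψ = ψ := fun ψ => by
    refine Lp.ext ?_
    filter_upwards [coeFn_phaseMap (c 0) (hc _) (h1 _) ψ] with x e
    rw [e, h0, one_mul]
  let U : ℝ → L2 ≃ₗᵢ[ℂ] L2 := fun t =>
    { toLinearEquiv := LinearEquiv.ofLinearMap (phaseMap (c t) (hc t) (h1 t)).toLinearMap
        (phaseMap (c (-t)) (hc _) (h1 _)).toLinearMap
        (LinearMap.ext fun ψ => by
          have := hgroup t (-t) ψ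
          simp only [add_neg_cancel, hid] at this
          exact this.symm)
        (LinearMap.ext fun ψ => by
          have := hgroup (-t) t ψ
          simp only [neg_add_cancel, hid] at this
          exact this.symm)
      norm_map' := fun ψ => (phaseMap (c t) (hc t) (h1 t)).norm_map ψ }
  have hU : ∀ t ψ, U t ψ =ᵐ[volume] fun x => c t x * ψ x := fun t ψ =>
    coeFn_phaseMap (c t) (hc t) (h1 t) ψ
  have hct : ∀ x, HasDerivAt (fun t => c t x) (-(Complex.I * k x)) 0 := fun x => by
    have h2 : HasDerivAt (fun t : ℝ => ((-(t * k x) : ℝ) : ℂ) * Complex.I)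
        (((-(1 * k x) : ℝ) : ℂ) * Complex.I) 0 :=
      (((hasDerivAt_id (0 : ℝ)).mul_const (k x)).neg.ofReal_comp).mul_const Complex.I
    convert h2.cexp using 1
    simp [mul_comm]
  have hcb : ∀ t x, ‖c t x - 1‖ ≤ |t| * |k x| := fun t x => by
    have := Real.norm_exp_I_mul_ofReal_sub_one_le (x := -(t * k x))
    rw [mul_comm] at this
    simpa [c, abs_mul] using this
  have hslope : ∀ (s : ℝ) ψ, ((s⁻¹ : ℝ) : ℂ) • (U s ψ - U 0 ψ) =ᵐ[volume]
      fun x => ((s⁻¹ : ℝ) : ℂ) * (c s x - 1) * ψ x := fun s ψ => by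
    rw [show U 0 ψ = ψ from hid ψ]
    filter_upwards [Lp.coeFn_smul ((s⁻¹ : ℝ) : ℂ) (U s ψ - ψ), Lp.coeFn_sub (U s ψ) ψ, hU s ψ] with x e1 e2 e3
    rw [e1, Pi.smul_apply, e2, Pi.sub_apply, e3, smul_eq_mul]
    ring
  have hlim : ∀ (u : ℕ → ℝ), Tendsto u atTop (𝓝[≠] 0) → ∀ x,
      Tendsto (fun n => (((u n)⁻¹ : ℝ) : ℂ) * (c (u n) x - 1)) atTop
        (𝓝 (-(Complex.I * k x))) := fun u hu x => by
    have := (hasDerivAt_iff_tendsto_slope_zero.1 (hct x)).comp hu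
    simpa [Function.comp_def, h0, Complex.real_smul] using this
  refine ⟨U, hgroup, fun ψ => ?_, fun ψ φ => ?_⟩
  · rw [continuous_iff_continuousAt]
    intro t
    refine tendsto_of_seq_tendsto fun u hu => ?_
    refine tendsto_L2_of_dominated (b := ψ) (fun n => hU (u n) ψ) (hU t ψ) ?_ ?_
    · exact Eventually.of_forall fun x n => by simp [h1]
    · refine Eventually.of_forall fun x => ?_
      have : Continuous fun t => c t x := by fun_prop
      exact ((this.tendsto t).comp hu).mul_const (ψ x)
  · have hiff : (∃ h : ψ ∈ (mulOp k).domain, φ = -(Complex.I • mulOp k ⟨ψ, h⟩)) ↔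
        φ =ᵐ[volume] fun x => -(Complex.I * k x) * ψ x := by
      have : (∃ h : ψ ∈ (mulOp k).domain, φ = -(Complex.I • mulOp k ⟨ψ, h⟩)) ↔
          ∃ h : ψ ∈ (mulOp k).domain, mulOp k ⟨ψ, h⟩ = Complex.I • φ := by
        refine exists_congr fun h => ⟨fun e => ?_, fun e => ?_⟩
        · rw [e, smul_neg, smul_smul, Complex.I_mul_I]; simp
        · rw [e, smul_smul, Complex.I_mul_I]; simp
      rw [this, exists_mulOp_eq_iff]
      constructor <;> intro h
      · filter_upwards [h, Lp.coeFn_smul Complex.I φ] with x e1 e2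
        rw [e2, Pi.smul_apply, smul_eq_mul] at e1
        calc φ x = -(Complex.I * (Complex.I * φ x)) := by rw [← mul_assoc, Complex.I_mul_I]; simp
          _ = _ := by rw [e1]; ring
      · filter_upwards [h, Lp.coeFn_smul Complex.I φ] with x e1 e2
        rw [e2, Pi.smul_apply, smul_eq_mul, e1]
        calc _ = -(Complex.I * Complex.I) * (k x * ψ x) := by ring
          _ = _ := by rw [Complex.I_mul_I]; simp
    rw [hiff, hasDerivAt_zero_iff_tendsto]
    constructor
    · intro h
      have h2 : Tendsto (fun n : ℕ => ((n : ℝ) + 1)⁻¹) atTop (𝓝[≠] 0) := by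
        refine tendsto_nhdsWithin_iff.2 ⟨?_, Eventually.of_forall fun n => ?_⟩
        · simpa using tendsto_one_div_add_atTop_nhds_zero_nat (𝕜 := ℝ)
        · have : (0 : ℝ) < ((n : ℝ) + 1)⁻¹ := by positivity
          exact this.ne'
      have h3 := h.comp h2
      obtain ⟨ns, hns, hae⟩ := (tendstoInMeasure_of_tendsto_Lp h3).exists_seq_tendsto_ae
      have h4 := ae_all_iff.2 fun n : ℕ => hslope (((n : ℝ) + 1)⁻¹) ψ
      filter_upwards [hae, h4] with x hx h4x
      refine tendsto_nhds_unique hx ?_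
      refine (((hlim _ h2 x).comp hns.tendsto_atTop).mul_const (ψ x)).congr fun i => ?_
      simp only [Function.comp_apply]
      exact (h4x _).symm
    · intro h
      refine tendsto_of_seq_tendsto fun u hu => ?_
      refine tendsto_L2_of_dominated (b := φ) (fun n => hslope (u n) ψ) h ?_ ?_
      · filter_upwards [h] with x hx n
        rw [hx, norm_mul, norm_mul, norm_mul, norm_neg, norm_mul, Complex.norm_I, one_mul]
        refine mul_le_mul_of_nonneg_right ?_ (norm_nonneg _)
        rw [Complex.norm_real, Complex.norm_real, norm_inv, Real.norm_eq_abs, Real.norm_eq_abs]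
        rcases eq_or_ne (u n) 0 with h0 | h0
        · simp [h0]
        · rw [inv_mul_le_iff₀ (abs_pos.2 h0)]
          exact hcb _ _
      · exact Eventually.of_forall fun x => (hlim u hu x).mul_const (ψ x)


/-- An `L²` function `h` equals `g * f` almost everywhere iff this holds for the associated
tempered distributions. -/
theorem toTemperedDistribution_eq_smulLeftCLM_iff {g : ℝ → ℂ} (hg : g.HasTemperateGrowth)
    (f h : L2) :
    (Lp.toTemperedDistribution h : 𝓢'(ℝ, ℂ)) =
      TemperedDistribution.smulLeftCLM ℂ g (Lp.toTemperedDistribution f) ↔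
      h =ᵐ[volume] fun x => g x * f x := by
  constructor
  · intro e
    refine ae_eq_of_integral_contDiff_smul_eq ((Lp.memLp h).locallyIntegrable one_le_two) ?_ ?_
    · have h1 := ((Lp.memLp f).locallyIntegrable one_le_two)
      exact h1.continuous_mul hg.1.continuous
    · intro u hu huc
      have hg₁ : HasCompactSupport (Complex.ofRealCLM ∘ u) := huc.comp_left rfl
      have hg₂ : ContDiff ℝ (⊤ : ℕ∞) (Complex.ofRealCLM ∘ u) := by fun_prop
      have := congrArg (fun T : 𝓢'(ℝ, ℂ) => T (hg₁.toSchwartzMap hg₂)) e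
      simp only [TemperedDistribution.smulLeftCLM_apply_apply, Lp.toTemperedDistribution_apply,
        SchwartzMap.smulLeftCLM_apply_apply hg] at this
      simpa [mul_assoc, mul_left_comm] using this
  · intro e
    ext u
    simp only [TemperedDistribution.smulLeftCLM_apply_apply, Lp.toTemperedDistribution_apply,
      SchwartzMap.smulLeftCLM_apply_apply hg]
    refine integral_congr_ae ?_
    filter_upwards [e] with x hx
    rw [hx, smul_eq_mul, smul_eq_mul, smul_eq_mul]
    ring

theorem toTemperedDistribution_injective :
    Function.Injective (Lp.toTemperedDistribution : L2 → 𝓢'(ℝ, ℂ)) := by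
  have h := LinearMap.ker_eq_bot.1
    (Lp.ker_toTemperedDistributionCLM_eq_bot (E := ℝ) (F := ℂ) (μ := volume) (p := 2))
  exact h

theorem toTemperedDistribution_add (f g : L2) :
    (Lp.toTemperedDistribution (f + g) : 𝓢'(ℝ, ℂ)) =
      Lp.toTemperedDistribution f + Lp.toTemperedDistribution g :=
  (Lp.toTemperedDistributionCLM ℂ (volume : Measure ℝ) 2).map_add f g

theorem toTemperedDistribution_smul (c : ℂ) (f : L2) :
    (Lp.toTemperedDistribution (c • f) : 𝓢'(ℝ, ℂ)) = c • Lp.toTemperedDistribution f :=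
  (Lp.toTemperedDistributionCLM ℂ (volume : Measure ℝ) 2).map_smul c f

/-- The Sobolev space `H²(ℝ)`, as a subspace of `L²(ℝ)`. -/
noncomputable def sobolevH2 : Submodule ℂ L2 where
  carrier := {ψ | TemperedDistribution.MemSobolev 2 2 (Lp.toTemperedDistribution ψ : 𝓢'(ℝ, ℂ))}
  zero_mem' := by
    have := (Lp.toTemperedDistributionCLM ℂ (volume : Measure ℝ) 2).map_zero
    rw [Lp.toTemperedDistributionCLM_apply] at this
    simp [this]
  add_mem' := fun {ψ φ} hψ hφ => by
    simpa [toTemperedDistribution_add] using hψ.add hφ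
  smul_mem' := fun c ψ hψ => by
    simpa [toTemperedDistribution_smul] using TemperedDistribution.MemSobolev.smul c hψ

theorem exists_neg_laplacian (ψ : sobolevH2) : ∃ φ : L2,
    (Lp.toTemperedDistribution φ : 𝓢'(ℝ, ℂ)) = -Δ (Lp.toTemperedDistribution (ψ : L2)) := by
  have h := ψ.2.laplacian.neg
  rw [sub_self, TemperedDistribution.memSobolev_zero_iff] at h
  obtain ⟨φ, hφ⟩ := h
  exact ⟨φ, hφ.symm⟩

/-- The free operator `H₀ = -d²/dx²` with domain `H²(ℝ)`: `H₀ ψ` is the `L²` function that represents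
the distribution `-ψ''`. -/
noncomputable def freeHamiltonian : L2 →ₗ.[ℂ] L2 where
  domain := sobolevH2
  toFun :=
    { toFun := fun ψ => (exists_neg_laplacian ψ).choose
      map_add' := fun ψ φ => by
        apply toTemperedDistribution_injective
        have hl := (LineDeriv.laplacianCLM ℂ ℝ 𝓢'(ℝ, ℂ)).map_add
        simp only [TemperedDistribution.laplacianCLM_apply] at hl
        rw [toTemperedDistribution_add, (exists_neg_laplacian _).choose_spec,
          (exists_neg_laplacian _).choose_spec, (exists_neg_laplacian _).choose_spec,
          Submodule.coe_add, toTemperedDistribution_add, hl, neg_add]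
      map_smul' := fun c ψ => by
        apply toTemperedDistribution_injective
        have hl := (LineDeriv.laplacianCLM ℂ ℝ 𝓢'(ℝ, ℂ)).map_smul
        simp only [TemperedDistribution.laplacianCLM_apply] at hl
        rw [RingHom.id_apply, toTemperedDistribution_smul, (exists_neg_laplacian _).choose_spec,
          (exists_neg_laplacian _).choose_spec, Submodule.coe_smul, toTemperedDistribution_smul,
          hl, smul_neg] }

theorem toTemperedDistribution_freeHamiltonian (ψ : freeHamiltonian.domain) :
    (Lp.toTemperedDistribution (freeHamiltonian ψ) : 𝓢'(ℝ, ℂ)) =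
      -Δ (Lp.toTemperedDistribution (ψ : L2)) :=
  (exists_neg_laplacian ψ).choose_spec

/-- The second derivative in the definition of `H₀` is the weak one. -/
theorem integral_mul_freeHamiltonian (ψ : freeHamiltonian.domain) (u : 𝓢(ℝ, ℂ)) :
    ∫ x, u x * freeHamiltonian ψ x = -∫ x, deriv (deriv u) x * (ψ : L2) x := by
  have h := congrArg (fun T : 𝓢'(ℝ, ℂ) => T u) (toTemperedDistribution_freeHamiltonian ψ)
  have h2 : ∀ x, (Δ u : 𝓢(ℝ, ℂ)) x = deriv (deriv u) x := fun x => by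
    rw [SchwartzMap.laplacian_apply, InnerProductSpace.laplacian_eq_iteratedDeriv_real,
      iteratedDeriv_succ, iteratedDeriv_one]
  simp only [_root_.neg_apply, TemperedDistribution.laplacian_apply_apply,
    Lp.toTemperedDistribution_apply, smul_eq_mul, h2] at h
  exact h

theorem fourier_neg_laplacian (ψ : L2) :
    𝓕 (-Δ (Lp.toTemperedDistribution ψ : 𝓢'(ℝ, ℂ))) =
      TemperedDistribution.smulLeftCLM ℂ (fun x : ℝ => (((2 * Real.pi * x) ^ 2 : ℝ) : ℂ))
        (Lp.toTemperedDistribution (𝓕 ψ)) := by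
  rw [TemperedDistribution.laplacian_eq_fourierMultiplierCLM, ← neg_smul, neg_neg,
    TemperedDistribution.fourierMultiplierCLM_apply, ← Complex.coe_smul,
    FourierTransform.fourier_smul, FourierTransform.fourier_fourierInv_eq,
    Lp.fourier_toTemperedDistribution_eq, ← _root_.smul_apply,
    ← TemperedDistribution.smulLeftCLM_smul (by fun_prop)]
  congr 2
  ext x
  simp [mul_pow]

/-- `H²(ℝ)` consists of the `L²` functions whose weak second derivative is in `L²`. -/
theorem mem_sobolevH2_iff (ψ : L2) : ψ ∈ sobolevH2 ↔
    ∃ φ : L2, (Lp.toTemperedDistribution φ : 𝓢'(ℝ, ℂ)) = -Δ (Lp.toTemperedDistribution ψ) := by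
  refine ⟨fun h => exists_neg_laplacian ⟨ψ, h⟩, ?_⟩
  rintro ⟨φ, e⟩
  refine TemperedDistribution.memSobolev_iff_exists_smulLeftCLM_fourier.2
    ⟨𝓕 ψ + (((2 * Real.pi) ^ 2 : ℝ) : ℂ)⁻¹ • 𝓕 φ, ?_⟩
  rw [Lp.fourier_toTemperedDistribution_eq]
  refine ((toTemperedDistribution_eq_smulLeftCLM_iff (by fun_prop) _ _).2 ?_).symm
  have e := congrArg (fun T : 𝓢'(ℝ, ℂ) => 𝓕 T) e
  simp only [Lp.fourier_toTemperedDistribution_eq, fourier_neg_laplacian] at e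
  rw [toTemperedDistribution_eq_smulLeftCLM_iff (by fun_prop)] at e
  filter_upwards [e, Lp.coeFn_add (𝓕 ψ) ((((2 * Real.pi) ^ 2 : ℝ) : ℂ)⁻¹ • 𝓕 φ),
    Lp.coeFn_smul (((2 * Real.pi) ^ 2 : ℝ) : ℂ)⁻¹ (𝓕 φ)] with x e1 e2 e3
  have hpi : (Real.pi : ℂ) ≠ 0 := by exact_mod_cast Real.pi_ne_zero
  rw [e2, Pi.add_apply, e3, Pi.smul_apply, e1]
  simp
  field_simp

/-- On the Fourier side the free Hamiltonian is multiplication by `(2πξ)²`. -/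
theorem exists_freeHamiltonian_eq_iff (ψ φ : L2) :
    (∃ h : ψ ∈ freeHamiltonian.domain, freeHamiltonian ⟨ψ, h⟩ = φ) ↔
      ∃ h : 𝓕 ψ ∈ (mulOp fun x => (2 * Real.pi * x) ^ 2).domain,
        mulOp (fun x => (2 * Real.pi * x) ^ 2) ⟨𝓕 ψ, h⟩ = 𝓕 φ := by
  rw [exists_mulOp_eq_iff, ← toTemperedDistribution_eq_smulLeftCLM_iff (by fun_prop),
    ← fourier_neg_laplacian, ← Lp.fourier_toTemperedDistribution_eq]
  constructor
  · rintro ⟨h, rfl⟩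
    rw [toTemperedDistribution_freeHamiltonian]
  · intro e
    have e' : (Lp.toTemperedDistribution φ : 𝓢'(ℝ, ℂ)) = -Δ (Lp.toTemperedDistribution ψ) := by
      have := congrArg (fun T : 𝓢'(ℝ, ℂ) => 𝓕⁻ T) e
      simpa only [FourierTransform.fourierInv_fourier_eq] using this
    refine ⟨(mem_sobolevH2_iff ψ).2 ⟨φ, e'⟩, toTemperedDistribution_injective ?_⟩
    rw [toTemperedDistribution_freeHamiltonian, e']

/-- The free Schrödinger group, built with the Fourier transform. -/
theorem exists_isUnitaryGroupOf_freeHamiltonian :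
    ∃ U : ℝ → L2 ≃ₗᵢ[ℂ] L2, IsUnitaryGroupOf U freeHamiltonian := by
  obtain ⟨U, hU⟩ := exists_isUnitaryGroupOf_mulOp (k := fun x => (2 * Real.pi * x) ^ 2)
    (by fun_prop)
  exact exists_isUnitaryGroupOf_conj hU (Lp.fourierTransformₗᵢ ℝ ℂ) exists_freeHamiltonian_eq_iff

/-- Multiplication by the real potential `V ∈ L^∞(ℝ)`, a bounded operator on `L²(ℝ)`. -/
noncomputable def potentialOp (V : LInfty) : L2 →L[ℂ] L2 :=
  LinearMap.mkContinuous
    { toFun := fun ψ => V • ψ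
      map_add' := fun ψ φ => Lp.add_smul V ψ φ
      map_smul' := fun c ψ => by
        refine Lp.ext ?_
        filter_upwards [Lp.coeFn_lpSMul (r := 2) V (c • ψ), Lp.coeFn_lpSMul (r := 2) V ψ,
          Lp.coeFn_smul c ψ, Lp.coeFn_smul c (V • ψ : L2)] with x h1 h2 h3 h4
        rw [h1, RingHom.id_apply, h4, Pi.smul_apply', Pi.smul_apply, h3, h2, Pi.smul_apply,
          Pi.smul_apply', smul_comm] }
    ‖V‖ fun ψ => Lp.norm_smul_le V ψ

theorem potentialOp_symmetric (V : LInfty) (ψ φ : L2) :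
    inner ℂ (potentialOp V ψ) φ = inner ℂ ψ (potentialOp V φ) := by
  rw [L2.inner_def, L2.inner_def]
  refine integral_congr_ae ?_
  filter_upwards [Lp.coeFn_lpSMul (r := 2) V ψ, Lp.coeFn_lpSMul (r := 2) V φ] with x h1 h2
  change inner ℂ ((V • ψ : L2) x) (φ x) = inner ℂ (ψ x) ((V • φ : L2) x)
  rw [h1, h2]
  simp [mul_assoc, mul_left_comm]

theorem coeFn_potentialOp (V : LInfty) (ψ : L2) :
    potentialOp V ψ =ᵐ[volume] fun x => (V x : ℂ) * ψ x := by
  filter_upwards [Lp.coeFn_lpSMul (r := 2) V ψ] with x h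
  rw [← Complex.real_smul]
  exact h

/-- The Schrödinger operator `H = -d²/dx² + V` with domain `H²(ℝ)`. -/
noncomputable def hamiltonian (V : LInfty) : L2 →ₗ.[ℂ] L2 :=
  (potentialOp V : L2 →ₗ[ℂ] L2) +ᵥ freeHamiltonian

theorem dense_sobolevH2 : Dense (sobolevH2 : Set L2) := by
  refine (SchwartzMap.denseRange_toLpCLM (E := ℝ) (F := ℂ) (p := 2) (μ := volume)
    ENNReal.ofNat_ne_top).mono ?_
  rintro _ ⟨f, rfl⟩
  have h := SchwartzMap.memSobolev (s := 2) (p := 2) f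
  rw [← Lp.toTemperedDistribution_toLp_eq (p := 2)] at h
  exact h

/-- There is exactly one strongly continuous unitary group whose generator is `-i H`. -/
theorem existsUnique_schrodingerGroup (V : LInfty) :
    ∃! U : ℝ → L2 ≃ₗᵢ[ℂ] L2, IsUnitaryGroupOf U (hamiltonian V) := by
  obtain ⟨U₀, hU₀⟩ := exists_isUnitaryGroupOf_freeHamiltonian
  obtain ⟨U, hU⟩ := exists_isUnitaryGroupOf_vadd hU₀ (potentialOp V) (potentialOp_symmetric V)
  exact ⟨U, hU, fun W hW => hW.unique dense_sobolevH2 hU⟩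

/-- The Schrödinger evolution `schrodingerGroup V t = exp (-i t H)`, where `H = -d²/dx² + V`: the
unique strongly continuous unitary group with generator `-i H`. -/
noncomputable def schrodingerGroup (V : LInfty) : ℝ → L2 ≃ₗᵢ[ℂ] L2 :=
  (existsUnique_schrodingerGroup V).choose

theorem schrodingerGroup_spec (V : LInfty) :
    IsUnitaryGroupOf (schrodingerGroup V) (hamiltonian V) :=
  (existsUnique_schrodingerGroup V).choose_spec.1

/-- The position operator `(X ψ)(x) = x ψ(x)` with domain `{ψ ∈ L² : x ψ ∈ L²}`. -/
noncomputable def position : L2 →ₗ.[ℂ] L2 := mulOp fun x => x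

/-- The operator `X²`, `(X² ψ)(x) = x² ψ(x)`, with domain `{ψ ∈ L² : x² ψ ∈ L²}`. -/
noncomputable def positionSq : L2 →ₗ.[ℂ] L2 := mulOp fun x => x ^ 2

/-- The Heisenberg evolution `X_H(t) = exp (i t H) X exp (-i t H)` of the position operator, with its
natural domain `{ψ : exp (-i t H) ψ ∈ D(X)}`. -/
noncomputable def heisenbergPosition (V : LInfty) (t : ℝ) : L2 →ₗ.[ℂ] L2 where
  domain := position.domain.comap (schrodingerGroup V t).toLinearEquiv.toLinearMap
  toFun := (schrodingerGroup V (-t)).toLinearEquiv.toLinearMap ∘ₗ position.toFun ∘ₗ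
    ((schrodingerGroup V t).toLinearEquiv.toLinearMap.restrict fun _ h => h)

theorem heisenbergPosition_apply (V : LInfty) (t : ℝ)
    (ψ : (heisenbergPosition V t).domain) :
    heisenbergPosition V t ψ =
      schrodingerGroup V (-t) (position ⟨schrodingerGroup V t ψ, ψ.2⟩) := rfl

end Concrete
end Schrodinger

/-!
Write `ψᵢ(t) = exp (-i t Hᵢ) ψ`, `δ = ‖V₁ - V₂‖` and `P = -i d/dx`. Formally
`d/dt X_H(t) ψ = exp (i t H) (2 P) exp (-i t H) ψ`, so the velocities of the two Heisenberg
evolutions differ by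
`2 exp (i t H₁) P (ψ₁(t) - ψ₂(t)) + 2 (exp (i t H₁) - exp (i t H₂)) P ψ₂(t)`.
Duhamel's formula gives `‖exp (-i t H₁) φ - exp (-i t H₂) φ‖ ≤ |t| δ ‖φ‖` for every `φ`, which controls
the second term by `|t| δ ‖P ψ₂(t)‖`. For the first, `‖P φ‖² ≤ ‖φ‖ ‖φ''‖` and
`‖ψᵢ(t)''‖ ≤ ‖ψ''‖ + 2 R ‖ψ‖` (as `Hᵢ` commutes with its evolution) give a bound by a multiple of
`(|t| δ)^{1/2}`. Integration in time yields the orders `|t|^{3/2} δ^{1/2}` and `t² δ`, and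
`δ ≤ (2 R)^{1/2} δ^{1/2}`.

To make this rigorous `X` is replaced by multiplication with `sin (k x) / k`, `0 < k ≤ 1`, which is
bounded by `|x|` and tends to `x` as `k → 0`. It is a combination of the modulations `exp (± i k x)`,
which are translations on the Fourier side, so that `H₀ exp (i k x) = exp (i k x) (H₀ + 2 k P + k²)`
holds on `H²(ℝ)` (`freeHamiltonian_modulation`). Hence the regularized position preserves `H²(ℝ)`, and
its commutator with `H₀` is at most `2 ‖P φ‖ + ‖φ‖`, uniformly in `k` (`norm_sinCommutator_le`). All
estimates are made at fixed `k`. Fatou's lemma then shows that `ψᵢ(t)` stays in the domain of `X`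
(`schrodingerGroup_mem_position_domain`), and dominated convergence gives the bound for `X` itself
(`norm_heisenbergPosition_sub_le`).
-/

namespace Schrodinger

/-! ### Modulations and the free Hamiltonian -/

/-- Multiplication by `x ↦ exp (i k x)`, an isometry of `L²(ℝ)`. -/
noncomputable def modulation (k : ℝ) : L2 →ₗᵢ[ℂ] L2 :=
  phaseMap (fun x => Complex.exp ((k * x : ℝ) * Complex.I)) (by fun_prop)
    fun _ => Complex.norm_exp_ofReal_mul_I _

theorem coeFn_modulation (k : ℝ) (ψ : L2) :
    modulation k ψ =ᵐ[volume] fun x => Complex.exp ((k * x : ℝ) * Complex.I) * ψ x :=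
  coeFn_phaseMap _ _ _ ψ

theorem fourierInv_compSubConst_apply (φ : 𝓢(ℝ, ℂ)) (a x : ℝ) :
    𝓕⁻ (φ.compSubConstCLM ℂ a) x =
      Complex.exp ((2 * Real.pi * a * x : ℝ) * Complex.I) * 𝓕⁻ φ x := by
  rw [SchwartzMap.fourierInv_coe, SchwartzMap.fourierInv_coe, Real.fourierInv_eq',
    Real.fourierInv_eq', ← integral_const_mul,
    ← integral_sub_right_eq_self (fun v => _ * (Complex.exp _ • φ v)) a]
  refine integral_congr_ae (Eventually.of_forall fun v => ?_)
  simp only [SchwartzMap.compSubConstCLM_apply, smul_eq_mul, ← mul_assoc, ← Complex.exp_add]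
  congr 2
  simp only [RCLike.inner_apply, conj_trivial]
  push_cast
  ring

/-- The Fourier transform carries a modulation to a translation. -/
theorem fourier_modulation (k : ℝ) (ψ : L2) :
    (𝓕 (modulation k ψ) : L2) =ᵐ[volume] fun ξ => (𝓕 ψ : L2) (ξ - k / (2 * Real.pi)) := by
  have hm := measurePreserving_sub_right (volume : Measure ℝ) (k / (2 * Real.pi))
  have key : (fun φ : L2 => modulation k (𝓕⁻ φ)) =
      fun φ : L2 => 𝓕⁻ (Lp.compMeasurePreserving _ hm φ : L2) := by
    refine (SchwartzMap.denseRange_toLpCLM (E := ℝ) (F := ℂ) (p := 2) (μ := volume)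
      ENNReal.ofNat_ne_top).equalizer ?_ ?_ (funext fun φ => ?_)
    · exact (modulation k).continuous.comp (Lp.fourierTransformₗᵢ ℝ ℂ).symm.continuous
    · exact (Lp.fourierTransformₗᵢ ℝ ℂ).symm.continuous.comp
        (Lp.isometry_compMeasurePreserving hm).continuous
    · have h1 : (Lp.compMeasurePreserving _ hm (φ.toLp 2 : L2) : L2) =
          (φ.compSubConstCLM ℂ (k / (2 * Real.pi))).toLp 2 := by
        refine Lp.ext ?_
        filter_upwards [Lp.coeFn_compMeasurePreserving (φ.toLp 2 : L2) hm,
          hm.quasiMeasurePreserving.ae (φ.coeFn_toLp 2 (volume : Measure ℝ)),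
          (φ.compSubConstCLM ℂ (k / (2 * Real.pi))).coeFn_toLp 2] with ξ e1 e2 e3
        rw [e1, e3, Function.comp_apply, e2, SchwartzMap.compSubConstCLM_apply]
      change modulation k (𝓕⁻ (φ.toLp 2 : L2)) =
        𝓕⁻ (Lp.compMeasurePreserving _ hm (φ.toLp 2 : L2) : L2)
      rw [h1, SchwartzMap.toLp_fourierInv_eq, SchwartzMap.toLp_fourierInv_eq]
      refine Lp.ext ?_
      filter_upwards [coeFn_modulation k ((𝓕⁻ φ).toLp 2), (𝓕⁻ φ).coeFn_toLp 2,
        (𝓕⁻ (φ.compSubConstCLM ℂ (k / (2 * Real.pi)))).coeFn_toLp 2] with x e1 e2 e3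
      rw [e1, e2, e3, fourierInv_compSubConst_apply]
      have : 2 * Real.pi * (k / (2 * Real.pi)) = k := by field_simp
      rw [this]
  have h := congrFun key (𝓕 ψ)
  simp only [FourierTransform.fourierInv_fourier_eq] at h
  rw [h, FourierTransform.fourier_fourierInv_eq]
  exact Lp.coeFn_compMeasurePreserving _ hm

/-- Every `ψ ∈ H²(ℝ)` has a momentum `p = -iψ'` in `L²(ℝ)`, given by multiplication with `2πξ` on the
Fourier side. By Cauchy-Schwarz its norm interpolates between those of `ψ` and `-ψ''`. -/
theorem exists_momentum {ψ : L2} (h : ψ ∈ freeHamiltonian.domain) :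
    ∃ p : L2, (𝓕 p : L2) =ᵐ[volume] (fun ξ => ((2 * Real.pi * ξ : ℝ) : ℂ) * (𝓕 ψ : L2) ξ) ∧
      ‖p‖ ^ 2 ≤ ‖ψ‖ * ‖freeHamiltonian ⟨ψ, h⟩‖ := by
  have hH := (exists_mulOp_eq_iff _ _ _).1
    ((exists_freeHamiltonian_eq_iff ψ _).1 ⟨h, rfl⟩)
  set φ := freeHamiltonian ⟨ψ, h⟩
  have hmem : MemLp (fun ξ => ((2 * Real.pi * ξ : ℝ) : ℂ) * (𝓕 ψ : L2) ξ) 2 volume := by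
    refine MemLp.of_le ((Lp.memLp (𝓕 ψ)).norm.add (Lp.memLp (𝓕 φ)).norm)
      ((by fun_prop : AEStronglyMeasurable (fun ξ : ℝ => ((2 * Real.pi * ξ : ℝ) : ℂ)) volume).mul
        (Lp.aestronglyMeasurable _)) ?_
    filter_upwards [hH] with ξ e
    rw [Pi.add_apply, e, Real.norm_of_nonneg (by positivity), norm_mul, norm_mul,
      Complex.norm_real, Complex.norm_real, norm_pow]
    nlinarith [norm_nonneg ((𝓕 ψ : L2) ξ), mul_nonneg (norm_nonneg ((𝓕 ψ : L2) ξ))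
      (sq_nonneg (‖2 * Real.pi * ξ‖ - 1)), norm_nonneg (2 * Real.pi * ξ)]
  refine ⟨𝓕⁻ (hmem.toLp), ?_, ?_⟩
  · rw [FourierTransform.fourier_fourierInv_eq]
    exact hmem.coeFn_toLp
  · have h1 : inner ℂ (hmem.toLp : L2) hmem.toLp = inner ℂ (𝓕 ψ) (𝓕 φ) := by
      rw [L2.inner_def, L2.inner_def]
      refine integral_congr_ae ?_
      filter_upwards [hmem.coeFn_toLp, hH] with ξ e1 e2
      rw [e1, e2, RCLike.inner_apply, RCLike.inner_apply, map_mul, Complex.conj_ofReal]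
      push_cast
      ring
    have h2 : ‖(𝓕⁻ (hmem.toLp : L2) : L2)‖ = ‖(hmem.toLp : L2)‖ :=
      (Lp.fourierTransformₗᵢ ℝ ℂ).symm.norm_map _
    rw [h2]
    calc ‖(hmem.toLp : L2)‖ ^ 2 = ‖inner ℂ (hmem.toLp : L2) hmem.toLp‖ := by
          rw [inner_self_eq_norm_sq_to_K]; simp
      _ ≤ ‖𝓕 ψ‖ * ‖𝓕 φ‖ := by rw [h1]; exact norm_inner_le_norm _ _
      _ = _ := by rw [Lp.norm_fourier_eq, Lp.norm_fourier_eq]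

/-- Conjugation by a modulation shifts the momentum: `H₀ e^{ikx} ψ = e^{ikx} (H₀ + 2kP + k²) ψ`. -/
theorem freeHamiltonian_modulation (k : ℝ) {ψ p : L2} (h : ψ ∈ freeHamiltonian.domain)
    (hp : (𝓕 p : L2) =ᵐ[volume] (fun ξ => ((2 * Real.pi * ξ : ℝ) : ℂ) * (𝓕 ψ : L2) ξ)) :
    ∃ h' : modulation k ψ ∈ freeHamiltonian.domain, freeHamiltonian ⟨modulation k ψ, h'⟩ =
      modulation k (freeHamiltonian ⟨ψ, h⟩ + ((2 * k : ℝ) : ℂ) • p + ((k ^ 2 : ℝ) : ℂ) • ψ) := by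
  have hH := (exists_mulOp_eq_iff _ _ _).1
    ((exists_freeHamiltonian_eq_iff ψ _).1 ⟨h, rfl⟩)
  rw [exists_freeHamiltonian_eq_iff, exists_mulOp_eq_iff]
  set φ := freeHamiltonian ⟨ψ, h⟩
  have hm := (measurePreserving_sub_right (volume : Measure ℝ)
    (k / (2 * Real.pi))).quasiMeasurePreserving
  have hs : 𝓕 (φ + ((2 * k : ℝ) : ℂ) • p + ((k ^ 2 : ℝ) : ℂ) • ψ) =
      𝓕 φ + ((2 * k : ℝ) : ℂ) • 𝓕 p + ((k ^ 2 : ℝ) : ℂ) • 𝓕 ψ := by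
    simp only [FourierTransform.fourier_add, FourierTransform.fourier_smul]
  filter_upwards [fourier_modulation k ψ,
    fourier_modulation k (φ + ((2 * k : ℝ) : ℂ) • p + ((k ^ 2 : ℝ) : ℂ) • ψ), hm.ae hH, hm.ae hp,
    hm.ae (Lp.coeFn_add (𝓕 φ + ((2 * k : ℝ) : ℂ) • 𝓕 p) (((k ^ 2 : ℝ) : ℂ) • 𝓕 ψ)),
    hm.ae (Lp.coeFn_add (𝓕 φ) (((2 * k : ℝ) : ℂ) • 𝓕 p)),
    hm.ae (Lp.coeFn_smul ((2 * k : ℝ) : ℂ) (𝓕 p)),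
    hm.ae (Lp.coeFn_smul ((k ^ 2 : ℝ) : ℂ) (𝓕 ψ))] with ξ e1 e2 e3 e4 e5 e6 e7 e8
  rw [e1, e2, hs, e5, Pi.add_apply, e6, Pi.add_apply, e7, e8, Pi.smul_apply, Pi.smul_apply, e3, e4]
  have hξ : 2 * Real.pi * ξ = 2 * Real.pi * (ξ - k / (2 * Real.pi)) + k := by field_simp; ring
  rw [hξ]
  generalize ξ - k / (2 * Real.pi) = η
  simp only [smul_eq_mul]
  push_cast
  ring

/-! ### The bounded approximations `sin (k x) / k` of the position operator -/

/-- Multiplication by `x ↦ sin (k x) / k`, a bounded approximation of the position operator as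
`k → 0`. It is written through modulations because these act on `H²(ℝ)` explicitly. -/
noncomputable def sinOp (k : ℝ) : L2 →L[ℂ] L2 :=
  (2 * Complex.I * k : ℂ)⁻¹ •
    ((modulation k).toContinuousLinearMap - (modulation (-k)).toContinuousLinearMap)

theorem sinOp_apply (k : ℝ) (ψ : L2) :
    sinOp k ψ = (2 * Complex.I * k : ℂ)⁻¹ • (modulation k ψ - modulation (-k) ψ) := rfl

theorem coeFn_sinOp (k : ℝ) (ψ : L2) :
    sinOp k ψ =ᵐ[volume] fun x => ((Real.sin (k * x) / k : ℝ) : ℂ) * ψ x := by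
  rw [sinOp_apply]
  filter_upwards [Lp.coeFn_smul (2 * Complex.I * k : ℂ)⁻¹ (modulation k ψ - modulation (-k) ψ),
    Lp.coeFn_sub (modulation k ψ) (modulation (-k) ψ), coeFn_modulation k ψ,
    coeFn_modulation (-k) ψ] with x e1 e2 e3 e4
  rw [e1, Pi.smul_apply, e2, Pi.sub_apply, e3, e4, smul_eq_mul]
  push_cast
  rw [Complex.sin, mul_inv, mul_inv, Complex.inv_I, neg_mul]
  ring

theorem potentialOp_sinOp (V : LInfty) (k : ℝ) (ψ : L2) :
    potentialOp V (sinOp k ψ) = sinOp k (potentialOp V ψ) := by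
  refine Lp.ext ?_
  filter_upwards [coeFn_potentialOp V (sinOp k ψ), coeFn_sinOp k ψ, coeFn_potentialOp V ψ,
    coeFn_sinOp k (potentialOp V ψ)] with x e1 e2 e3 e4
  rw [e1, e2, e4, e3]
  ring

theorem norm_sin_div_mul_le (k x : ℝ) (z : ℂ) :
    ‖((Real.sin (k * x) / k : ℝ) : ℂ) * z‖ ≤ ‖(x : ℂ) * z‖ := by
  rw [norm_mul, norm_mul, Complex.norm_real, Complex.norm_real, norm_div]
  refine mul_le_mul_of_nonneg_right (div_le_of_le_mul₀ (norm_nonneg _) (norm_nonneg _) ?_)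
    (norm_nonneg _)
  rw [mul_comm, ← norm_mul]
  exact Real.abs_sin_le_abs

theorem norm_sinOp_le (k : ℝ) (ψ : position.domain) : ‖sinOp k ψ‖ ≤ ‖position ψ‖ := by
  refine Lp.norm_le_norm_of_ae_le ?_
  filter_upwards [coeFn_sinOp k ψ, coeFn_mulOp _ ψ] with x e1 e2
  rw [e1]
  exact (norm_sin_div_mul_le _ _ _).trans_eq (congrArg norm e2.symm)

theorem tendsto_sin_div (x : ℝ) :
    Tendsto (fun n : ℕ => Real.sin (((n : ℝ) + 1)⁻¹ * x) / ((n : ℝ) + 1)⁻¹) atTop (𝓝 x) := by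
  have h : HasDerivAt (fun k : ℝ => Real.sin (k * x)) x 0 := by
    simpa using ((hasDerivAt_id (0 : ℝ)).mul_const x).sin
  have h2 : Tendsto (fun n : ℕ => ((n : ℝ) + 1)⁻¹) atTop (𝓝[≠] 0) := by
    refine tendsto_nhdsWithin_iff.2 ⟨?_, Eventually.of_forall fun n => ?_⟩
    · simpa using tendsto_one_div_add_atTop_nhds_zero_nat (𝕜 := ℝ)
    · have : (0 : ℝ) < ((n : ℝ) + 1)⁻¹ := by positivity
      exact this.ne'
  refine ((hasDerivAt_iff_tendsto_slope_zero.1 h).comp h2).congr fun n => ?_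
  simp [div_eq_inv_mul]

theorem tendsto_sinOp (ψ : position.domain) :
    Tendsto (fun n : ℕ => sinOp ((n : ℝ) + 1)⁻¹ ψ) atTop (𝓝 (position ψ)) := by
  refine tendsto_L2_of_dominated (b := position ψ) (fun n => coeFn_sinOp _ _) (coeFn_mulOp _ ψ)
    ?_ (Eventually.of_forall fun x => ?_)
  · filter_upwards [coeFn_mulOp _ ψ] with x e n
    exact (norm_sin_div_mul_le _ _ _).trans_eq (congrArg norm e.symm)
  · exact ((Complex.continuous_ofReal.tendsto x).comp (tendsto_sin_div x)).mul_const _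

/-- By Fatou's lemma, `ψ` lies in the domain of the position operator as soon as the bounded
approximations are bounded on `ψ`. -/
theorem mem_position_domain_of_norm_sinOp_le {ψ : L2} {C : ℝ}
    (h : ∀ n : ℕ, ‖sinOp ((n : ℝ) + 1)⁻¹ ψ‖ ≤ C) : ψ ∈ position.domain := by
  refine ⟨(by fun_prop : AEStronglyMeasurable (fun x : ℝ => (x : ℂ)) volume).mul
    (Lp.aestronglyMeasurable ψ), ?_⟩
  refine (Lp.eLpNorm_le_of_ae_tendsto (C := ENNReal.ofReal C) (u := atTop)
    (f := fun n : ℕ => (sinOp ((n : ℝ) + 1)⁻¹ ψ : ℝ → ℂ)) (Eventually.of_forall fun n => ?_)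
    (fun n => Lp.aestronglyMeasurable _) ?_).trans_lt ENNReal.ofReal_lt_top
  · rw [← ENNReal.ofReal_toReal (Lp.eLpNorm_ne_top _), ← Lp.norm_def]
    exact ENNReal.ofReal_le_ofReal (h n)
  · filter_upwards [ae_all_iff.2 fun n : ℕ => coeFn_sinOp ((n : ℝ) + 1)⁻¹ ψ] with x e
    simp only [e]
    exact ((Complex.continuous_ofReal.tendsto x).comp (tendsto_sin_div x)).mul_const _

theorem positionSq_domain_le : positionSq.domain ≤ position.domain := by
  intro ψ hψ
  have hψ : MemLp (fun x : ℝ => ((x ^ 2 : ℝ) : ℂ) * ψ x) 2 volume := hψ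
  refine MemLp.of_le ((Lp.memLp ψ).norm.add hψ.norm)
    ((by fun_prop : AEStronglyMeasurable (fun x : ℝ => (x : ℂ)) volume).mul
      (Lp.aestronglyMeasurable ψ)) (Eventually.of_forall fun x => ?_)
  rw [Pi.add_apply, Real.norm_of_nonneg (by positivity), norm_mul, norm_mul, Complex.norm_real,
    Complex.norm_real, norm_pow]
  nlinarith [norm_nonneg (ψ x), mul_nonneg (norm_nonneg (ψ x)) (sq_nonneg (‖x‖ - 1)),
    norm_nonneg x]

/-! ### The commutator of the free Hamiltonian with the approximate position -/

theorem sinOp_mem_freeHamiltonian_domain (k : ℝ) {ψ : L2} (h : ψ ∈ freeHamiltonian.domain) : sinOp k ψ ∈ freeHamiltonian.domain := by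
  obtain ⟨p, hp, -⟩ := exists_momentum h
  exact Submodule.smul_mem _ _ (Submodule.sub_mem _ (freeHamiltonian_modulation k h hp).1
    (freeHamiltonian_modulation (-k) h hp).1)

/-- The commutator `[H₀, sin (k x) / k]` on `H²(ℝ)`. -/
noncomputable def sinCommutator (k : ℝ) : freeHamiltonian.domain →ₗ[ℂ] L2 :=
  freeHamiltonian.toFun ∘ₗ
      ((sinOp k : L2 →ₗ[ℂ] L2).restrict fun _ h =>
         sinOp_mem_freeHamiltonian_domain k h) -
    (sinOp k : L2 →ₗ[ℂ] L2) ∘ₗ freeHamiltonian.toFun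

theorem sinCommutator_apply (k : ℝ) (ψ : freeHamiltonian.domain) :
    sinCommutator k ψ = freeHamiltonian ⟨sinOp k ψ, sinOp_mem_freeHamiltonian_domain k ψ.2⟩ -
      sinOp k (freeHamiltonian ψ) := rfl

/-- The commutator equals `-2i cos (k x) P + k sin (k x)`, so the momentum controls it uniformly
in `k`. -/
theorem norm_sinCommutator_le {k : ℝ} (hk : k ≠ 0) (hk1 : |k| ≤ 1) (ψ : freeHamiltonian.domain) :
    ‖sinCommutator k ψ‖ ≤ 2 * √(‖(ψ : L2)‖ * ‖freeHamiltonian ψ‖) + ‖(ψ : L2)‖ := by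
  obtain ⟨p, hp, hpn⟩ := exists_momentum ψ.2
  obtain ⟨h1, e1⟩ := freeHamiltonian_modulation k ψ.2 hp
  obtain ⟨h2, e2⟩ := freeHamiltonian_modulation (-k) ψ.2 hp
  set φ := freeHamiltonian ψ with hφ
  change _ = modulation k (φ + _ + _) at e1
  change _ = modulation (-k) (φ + _ + _) at e2
  have e : sinCommutator k ψ = (2 * Complex.I * k : ℂ)⁻¹ •
      (modulation k (((2 * k : ℝ) : ℂ) • p + ((k ^ 2 : ℝ) : ℂ) • (ψ : L2)) +
        modulation (-k) (((2 * k : ℝ) : ℂ) • p - ((k ^ 2 : ℝ) : ℂ) • (ψ : L2))) := by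
    have h3 : freeHamiltonian ⟨sinOp k ψ, sinOp_mem_freeHamiltonian_domain k ψ.2⟩ =
        (2 * Complex.I * k : ℂ)⁻¹ • (freeHamiltonian ⟨modulation k ψ, h1⟩ -
          freeHamiltonian ⟨modulation (-k) ψ, h2⟩) := by
      rw [← LinearPMap.map_sub, ← LinearPMap.map_smul]
      rfl
    rw [sinCommutator_apply, h3, e1, e2, ← hφ, sinOp_apply, ← smul_sub]
    congr 1
    simp only [_root_.map_add, map_sub, map_smul]
    push_cast
    simp only [mul_neg, neg_smul, even_two, Even.neg_pow]
    abel
  have hn : ∀ q : L2, ‖((2 * k : ℝ) : ℂ) • q‖ = 2 * |k| * ‖q‖ := fun q => by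
    rw [norm_smul, Complex.norm_real, norm_mul]; simp
  have hn2 : ‖((k ^ 2 : ℝ) : ℂ) • (ψ : L2)‖ = |k| ^ 2 * ‖(ψ : L2)‖ := by
    rw [norm_smul, Complex.norm_real, norm_pow]; simp
  have hp' : ‖p‖ ≤ √(‖(ψ : L2)‖ * ‖φ‖) := Real.le_sqrt_of_sq_le hpn
  have hk0 : 0 < |k| := abs_pos.2 hk
  rw [e, norm_smul, norm_inv, norm_mul, norm_mul, Complex.norm_I, Complex.norm_real,
    Real.norm_eq_abs, inv_mul_le_iff₀ (by simpa using hk)]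
  refine (norm_add_le _ _).trans ?_
  rw [LinearIsometry.norm_map, LinearIsometry.norm_map]
  have a1 := norm_add_le (((2 * k : ℝ) : ℂ) • p) (((k ^ 2 : ℝ) : ℂ) • (ψ : L2))
  have a2 := norm_sub_le (((2 * k : ℝ) : ℂ) • p) (((k ^ 2 : ℝ) : ℂ) • (ψ : L2))
  rw [hn, hn2] at a1 a2
  have a3 : |k| * ‖(ψ : L2)‖ ≤ ‖(ψ : L2)‖ := mul_le_of_le_one_left (norm_nonneg _) hk1
  have a4 := mul_le_mul_of_nonneg_left a3 hk0.le
  have a5 := mul_le_mul_of_nonneg_left hp' hk0.le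
  simp only [RCLike.norm_ofNat]
  nlinarith

/-! ### Abstract unitary groups -/

section Abstract

variable {E : Type*} [NormedAddCommGroup E] [InnerProductSpace ℂ E]

namespace IsUnitaryGroupOf

variable {U : ℝ → E ≃ₗᵢ[ℂ] E} {A : E →ₗ.[ℂ] E}

/-- Product rule for `s ↦ exp (i s A) (y s)`. The curve need not take values in the domain of `A`
away from `t`: only strong continuity of the group acts on the increment of `y`. -/
theorem hasDerivAt_neg_apply (hU : IsUnitaryGroupOf U A) {y : ℝ → E} {y' : E} {t : ℝ}
    (hy : HasDerivAt y y' t) (ht : y t ∈ A.domain) :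
    HasDerivAt (fun s => U (-s) (y s)) (U (-t) (y' + Complex.I • A ⟨y t, ht⟩)) t := by
  have h1 : HasDerivAt (fun s => U (-s) (y t)) (U (-t) (Complex.I • A ⟨y t, ht⟩)) t := by
    have := (hU.hasDerivAt ⟨y t, ht⟩ (-t)).scomp t (hasDerivAt_neg t)
    simpa [Function.comp_def] using this
  have h2 : HasDerivAt (fun s => U (-s) (y s - y t)) (U (-t) y') t := by
    rw [hasDerivAt_iff_tendsto_slope] at hy ⊢
    have h3 : Tendsto (fun s => U (-s) (slope y t s - y')) (𝓝[≠] t) (𝓝 0) := by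
      rw [tendsto_zero_iff_norm_tendsto_zero]
      simp only [LinearIsometryEquiv.norm_map]
      rw [← tendsto_zero_iff_norm_tendsto_zero]
      simpa using hy.sub_const y'
    have h4 := h3.add ((((hU.continuous y').comp continuous_neg).tendsto t).mono_left
      nhdsWithin_le_nhds)
    simp only [zero_add, Function.comp_def] at h4
    refine h4.congr fun s => ?_
    rw [← _root_.map_add, sub_add_cancel]
    simp only [slope_def_module, sub_self, map_zero, sub_zero]
    exact (((U (-s) : E ≃L[ℂ] E) : E →L[ℂ] E).restrictScalars ℝ).map_smul _ _
  rw [_root_.map_add]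
  convert h2.add h1 using 1
  ext s
  rw [Pi.add_apply, ← _root_.map_add, sub_add_cancel]

theorem norm_apply_eq (hU : IsUnitaryGroupOf U A) (ψ : A.domain) (t : ℝ)
    (h : U t (ψ : E) ∈ A.domain) : ‖A ⟨U t ψ, h⟩‖ = ‖A ψ‖ := by
  obtain ⟨_, e⟩ := hU.apply_mem_domain ψ t
  have := congrArg norm e
  simpa [norm_smul] using this.symm

/-- The commutator `[A, S]` governs the Heisenberg evolution `exp (i t A) S exp (-i t A)` of a
bounded operator `S` that preserves the domain. -/
theorem hasDerivAt_heisenberg (hU : IsUnitaryGroupOf U A) (S : E →L[ℂ] E)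
    (hS : ∀ φ ∈ A.domain, S φ ∈ A.domain) (ψ : A.domain) (t : ℝ) (ht : U t (ψ : E) ∈ A.domain) :
    HasDerivAt (fun s => U (-s) (S (U s (ψ : E))))
      (U (-t) (Complex.I • (A ⟨S (U t ψ), hS _ ht⟩ - S (A ⟨U t ψ, ht⟩)))) t := by
  obtain ⟨h1, e1⟩ := hU.apply_mem_domain ψ t
  have hy : HasDerivAt (fun s => S (U s (ψ : E))) (S (U t (-(Complex.I • A ψ)))) t :=
    (S.restrictScalars ℝ).hasFDerivAt.comp_hasDerivAt t (hU.hasDerivAt ψ t)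
  convert hU.hasDerivAt_neg_apply hy (hS _ ht) using 2
  rw [e1, map_neg, map_smul, smul_sub]
  abel

/-- Duhamel's estimate: a bounded perturbation of the generator changes the group by at most
`|t|` times the size of the perturbation. -/
theorem norm_sub_le {W : ℝ → E ≃ₗᵢ[ℂ] E} {B : E →ₗ.[ℂ] E} (hU : IsUnitaryGroupOf U A)
    (hW : IsUnitaryGroupOf W B) (hA : Dense (A.domain : Set E)) (hAB : A.domain = B.domain)
    {δ : ℝ} (hδ : ∀ (φ : E) (h : φ ∈ A.domain) (h' : φ ∈ B.domain),
      ‖A ⟨φ, h⟩ - B ⟨φ, h'⟩‖ ≤ δ * ‖φ‖) (t : ℝ) (φ : E) :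
    ‖U t φ - W t φ‖ ≤ |t| * δ * ‖φ‖ := by
  revert φ
  have hcl : IsClosed {φ : E | ‖U t φ - W t φ‖ ≤ |t| * δ * ‖φ‖} := by
    refine isClosed_le ?_ (by fun_prop)
    exact ((U t).continuous.sub (W t).continuous).norm
  intro φ
  refine hcl.closure_subset_iff.2 (fun φ hφ => ?_) (hA.closure_eq ▸ Set.mem_univ φ)
  have hφB : φ ∈ B.domain := hAB ▸ hφ
  have hB : ∀ s, W s φ ∈ B.domain := fun s => (hW.apply_mem_domain ⟨φ, hφB⟩ s).1
  have hA' : ∀ s, W s φ ∈ A.domain := fun s => hAB ▸ hB s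
  have hd : ∀ s, HasDerivAt (fun s => U (-s) (W s φ))
      (U (-s) (Complex.I • (A ⟨W s φ, hA' s⟩ - B ⟨W s φ, hB s⟩))) s := fun s => by
    obtain ⟨_, e⟩ := hW.apply_mem_domain ⟨φ, hφB⟩ s
    convert hU.hasDerivAt_neg_apply (hW.hasDerivAt ⟨φ, hφB⟩ s) (hA' s) using 2
    rw [e, smul_sub]
    abel
  have h := convex_univ.norm_image_sub_le_of_norm_hasDerivWithin_le (C := δ * ‖φ‖)
    (fun s _ => (hd s).hasDerivWithinAt) (fun s _ => ?_) (Set.mem_univ 0) (Set.mem_univ t)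
  · have e : ‖U t φ - W t φ‖ = ‖U (-t) (W t φ) - φ‖ := by
      rw [← (U t).norm_map (U (-t) (W t φ) - φ), map_sub, hU.apply_neg_apply, norm_sub_rev]
    change ‖U t φ - W t φ‖ ≤ |t| * δ * ‖φ‖
    rw [e]
    simp only [neg_zero, hU.map_zero_apply, hW.map_zero_apply, sub_zero, Real.norm_eq_abs] at h
    linarith
  · rw [LinearIsometryEquiv.norm_map, norm_smul, Complex.norm_I, one_mul]
    exact (hδ _ _ _).trans_eq (by rw [LinearIsometryEquiv.norm_map])

end IsUnitaryGroupOf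

end Abstract

/-! ### Schrödinger evolutions -/

theorem hamiltonian_apply (V : LInfty) {φ : L2} (h' : φ ∈ (hamiltonian V).domain)
    (h : φ ∈ freeHamiltonian.domain) :
    hamiltonian V ⟨φ, h'⟩ = potentialOp V φ + freeHamiltonian ⟨φ, h⟩ := rfl

theorem norm_potentialOp_le (V : LInfty) (φ : L2) : ‖potentialOp V φ‖ ≤ ‖V‖ * ‖φ‖ :=
  Lp.norm_smul_le V φ

theorem schrodingerGroup_mem (V : LInfty) (φ : freeHamiltonian.domain) (t : ℝ) :
    schrodingerGroup V t φ ∈ freeHamiltonian.domain :=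
  ((schrodingerGroup_spec V).apply_mem_domain φ t).1

/-- The kinetic energy operator stays bounded along the evolution, because `H = H₀ + V` commutes
with the evolution and `V` is bounded. -/
theorem norm_freeHamiltonian_schrodingerGroup_le (V : LInfty) (ψ : freeHamiltonian.domain)
    (t : ℝ) : ‖freeHamiltonian ⟨schrodingerGroup V t ψ, schrodingerGroup_mem V ψ t⟩‖ ≤
      ‖freeHamiltonian ψ‖ + 2 * ‖V‖ * ‖(ψ : L2)‖ := by
  have hψ : (ψ : L2) ∈ (hamiltonian V).domain := ψ.2
  have hψt : schrodingerGroup V t ψ ∈ (hamiltonian V).domain := schrodingerGroup_mem V ψ t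
  have h : ‖hamiltonian V ⟨_, hψt⟩‖ = ‖hamiltonian V ⟨_, hψ⟩‖ :=
    (schrodingerGroup_spec V).norm_apply_eq ⟨_, hψ⟩ t hψt
  have h1 := hamiltonian_apply V hψt (schrodingerGroup_mem V ψ t)
  have h2 : hamiltonian V ⟨_, hψ⟩ = potentialOp V ψ + freeHamiltonian ψ := rfl
  rw [← sub_eq_iff_eq_add'] at h1
  rw [← h1]
  refine (norm_sub_le _ _).trans ?_
  rw [h, h2]
  have h3 := norm_add_le (potentialOp V ψ) (freeHamiltonian ψ)
  have h4 := norm_potentialOp_le V ψ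
  have h5 := norm_potentialOp_le V (schrodingerGroup V t ψ)
  rw [LinearIsometryEquiv.norm_map] at h5
  linarith

theorem norm_schrodingerGroup_sub_le (V₁ V₂ : LInfty) (t : ℝ) (φ : L2) :
    ‖schrodingerGroup V₁ t φ - schrodingerGroup V₂ t φ‖ ≤ |t| * ‖V₁ - V₂‖ * ‖φ‖ := by
  refine (schrodingerGroup_spec V₁).norm_sub_le (schrodingerGroup_spec V₂) dense_sobolevH2 rfl
    (fun φ h h' => ?_) t φ
  have e : hamiltonian V₁ ⟨φ, h⟩ - hamiltonian V₂ ⟨φ, h'⟩ = potentialOp (V₁ - V₂) φ := by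
    rw [hamiltonian_apply V₁ h h, hamiltonian_apply V₂ h' h, add_sub_add_right_eq_sub]
    refine Lp.ext ?_
    filter_upwards [Lp.coeFn_sub (potentialOp V₁ φ) (potentialOp V₂ φ), coeFn_potentialOp V₁ φ,
      coeFn_potentialOp V₂ φ, coeFn_potentialOp (V₁ - V₂) φ, Lp.coeFn_sub V₁ V₂]
      with x e1 e2 e3 e4 e5
    rw [e1, Pi.sub_apply, e2, e3, e4, e5, Pi.sub_apply]
    push_cast
    ring
  rw [e]
  exact norm_potentialOp_le _ _

/-- The potential commutes with `sin (k x) / k`, so only the free commutator enters the Heisenberg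
equation. -/
theorem hasDerivAt_heisenberg_sinOp (V : LInfty) (k : ℝ) (ψ : freeHamiltonian.domain) (t : ℝ) :
    HasDerivAt (fun s => schrodingerGroup V (-s) (sinOp k (schrodingerGroup V s ψ)))
      (schrodingerGroup V (-t) (Complex.I •
        sinCommutator k ⟨schrodingerGroup V t ψ, schrodingerGroup_mem V ψ t⟩)) t := by
  have ht := schrodingerGroup_mem V ψ t
  have hS := sinOp_mem_freeHamiltonian_domain k ht
  have e : hamiltonian V ⟨sinOp k (schrodingerGroup V t ψ), hS⟩ -
      sinOp k (hamiltonian V ⟨schrodingerGroup V t ψ, ht⟩) =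
      sinCommutator k ⟨schrodingerGroup V t ψ, ht⟩ := by
    rw [hamiltonian_apply V hS hS, hamiltonian_apply V ht ht, _root_.map_add, potentialOp_sinOp,
      add_sub_add_left_eq_sub, sinCommutator_apply]
  rw [← e]
  exact (schrodingerGroup_spec V).hasDerivAt_heisenberg (sinOp k)
    (fun φ h => sinOp_mem_freeHamiltonian_domain k h) ψ t ht

/-- A bound for the speed at which the approximate position moves, uniform in `k`. -/
theorem norm_sinCommutator_schrodingerGroup_le {k : ℝ} (hk : k ≠ 0) (hk1 : |k| ≤ 1) {R : ℝ}
    {V : LInfty} (hV : ‖V‖ ≤ R) (ψ : freeHamiltonian.domain) (t : ℝ) :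
    ‖sinCommutator k ⟨schrodingerGroup V t ψ, schrodingerGroup_mem V ψ t⟩‖ ≤
      2 * √(‖(ψ : L2)‖ * (‖freeHamiltonian ψ‖ + 2 * R * ‖(ψ : L2)‖)) + ‖(ψ : L2)‖ := by
  refine (norm_sinCommutator_le hk hk1 _).trans ?_
  have h := norm_freeHamiltonian_schrodingerGroup_le V ψ t
  simp only [LinearIsometryEquiv.norm_map]
  gcongr
  exact h.trans (by gcongr)

theorem norm_sinOp_schrodingerGroup_le {k : ℝ} (hk : k ≠ 0) (hk1 : |k| ≤ 1) (V : LInfty)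
    (ψ : freeHamiltonian.domain) (t : ℝ) :
    ‖sinOp k (schrodingerGroup V t ψ)‖ ≤ ‖sinOp k ψ‖ +
      (2 * √(‖(ψ : L2)‖ * (‖freeHamiltonian ψ‖ + 2 * ‖V‖ * ‖(ψ : L2)‖)) + ‖(ψ : L2)‖) * |t| := by
  have h := convex_univ.norm_image_sub_le_of_norm_hasDerivWithin_le
    (C := 2 * √(‖(ψ : L2)‖ * (‖freeHamiltonian ψ‖ + 2 * ‖V‖ * ‖(ψ : L2)‖)) + ‖(ψ : L2)‖)
    (fun s _ => (hasDerivAt_heisenberg_sinOp V k ψ s).hasDerivWithinAt) (fun s _ => ?_)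
    (Set.mem_univ 0) (Set.mem_univ t)
  · simp only [neg_zero, (schrodingerGroup_spec V).map_zero_apply, sub_zero, Real.norm_eq_abs] at h
    have h2 := norm_le_insert' (schrodingerGroup V (-t) (sinOp k (schrodingerGroup V t ψ)))
      (sinOp k ψ)
    rw [LinearIsometryEquiv.norm_map] at h2
    exact h2.trans (by gcongr)
  · rw [LinearIsometryEquiv.norm_map, norm_smul, Complex.norm_I, one_mul]
    exact norm_sinCommutator_schrodingerGroup_le hk hk1 le_rfl ψ s

/-- The difference of the velocities of two evolutions has two parts: Duhamel's estimate bounds the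
effect of the outer groups, and the commutator estimate, applied to the difference of the two
orbits, turns their distance into its square root. -/
theorem norm_heisenberg_velocity_sub_le {k : ℝ} (hk : k ≠ 0) (hk1 : |k| ≤ 1) {R : ℝ}
    {V₁ V₂ : LInfty} (h₁ : ‖V₁‖ ≤ R) (h₂ : ‖V₂‖ ≤ R) (ψ : freeHamiltonian.domain) (t : ℝ)
    {N M δ : ℝ} (hN : N = ‖(ψ : L2)‖) (hM : M = ‖freeHamiltonian ψ‖ + 2 * R * ‖(ψ : L2)‖)
    (hδ : δ = ‖V₁ - V₂‖) :
    ‖schrodingerGroup V₁ (-t) (Complex.I •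
          sinCommutator k ⟨schrodingerGroup V₁ t ψ, schrodingerGroup_mem V₁ ψ t⟩) -
        schrodingerGroup V₂ (-t) (Complex.I •
          sinCommutator k ⟨schrodingerGroup V₂ t ψ, schrodingerGroup_mem V₂ ψ t⟩)‖ ≤
      2 * √(|t| * δ * N * (2 * M)) + |t| * δ * N + |t| * δ * (2 * √(N * M) + N) := by
  set ψ₁ : freeHamiltonian.domain := ⟨schrodingerGroup V₁ t ψ, schrodingerGroup_mem V₁ ψ t⟩
  set ψ₂ : freeHamiltonian.domain := ⟨schrodingerGroup V₂ t ψ, schrodingerGroup_mem V₂ ψ t⟩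
  have e : schrodingerGroup V₁ (-t) (Complex.I • sinCommutator k ψ₁) -
      schrodingerGroup V₂ (-t) (Complex.I • sinCommutator k ψ₂) =
      schrodingerGroup V₁ (-t) (Complex.I • sinCommutator k (ψ₁ - ψ₂)) +
        (schrodingerGroup V₁ (-t) (Complex.I • sinCommutator k ψ₂) -
          schrodingerGroup V₂ (-t) (Complex.I • sinCommutator k ψ₂)) := by
    rw [map_sub, smul_sub, map_sub]
    abel
  rw [e]
  refine (norm_add_le _ _).trans (add_le_add ?_ ?_)
  · rw [LinearIsometryEquiv.norm_map, norm_smul, Complex.norm_I, one_mul]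
    refine (norm_sinCommutator_le hk hk1 _).trans ?_
    have d1 : ‖((ψ₁ - ψ₂ : freeHamiltonian.domain) : L2)‖ ≤ |t| * δ * N := by
      rw [hδ, hN]
      exact norm_schrodingerGroup_sub_le V₁ V₂ t ψ
    have d2 : ‖freeHamiltonian (ψ₁ - ψ₂)‖ ≤ 2 * M := by
      rw [LinearPMap.map_sub]
      refine (norm_sub_le _ _).trans ?_
      have b1 := norm_freeHamiltonian_schrodingerGroup_le V₁ ψ t
      have b2 := norm_freeHamiltonian_schrodingerGroup_le V₂ ψ t
      have c1 := mul_le_mul_of_nonneg_right h₁ (norm_nonneg (ψ : L2))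
      have c2 := mul_le_mul_of_nonneg_right h₂ (norm_nonneg (ψ : L2))
      rw [hM]
      linarith
    have hM0 : 0 ≤ 2 * M := (norm_nonneg _).trans d2
    gcongr
    exact (norm_nonneg _).trans d1
  · refine (norm_schrodingerGroup_sub_le V₁ V₂ (-t) _).trans ?_
    rw [abs_neg, norm_smul, Complex.norm_I, one_mul, hδ, hM, hN]
    gcongr
    exact norm_sinCommutator_schrodingerGroup_le hk hk1 h₂ ψ t

theorem norm_heisenberg_sinOp_sub_le {k : ℝ} (hk : k ≠ 0) (hk1 : |k| ≤ 1) {R : ℝ}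
    {V₁ V₂ : LInfty} (h₁ : ‖V₁‖ ≤ R) (h₂ : ‖V₂‖ ≤ R) (ψ : freeHamiltonian.domain) (t : ℝ)
    {N M δ : ℝ} (hN : N = ‖(ψ : L2)‖) (hM : M = ‖freeHamiltonian ψ‖ + 2 * R * ‖(ψ : L2)‖)
    (hδ : δ = ‖V₁ - V₂‖) :
    ‖schrodingerGroup V₁ (-t) (sinOp k (schrodingerGroup V₁ t ψ)) -
        schrodingerGroup V₂ (-t) (sinOp k (schrodingerGroup V₂ t ψ))‖ ≤
      (2 * √(|t| * δ * N * (2 * M)) + |t| * δ * N + |t| * δ * (2 * √(N * M) + N)) * |t| := by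
  have h := (convex_Icc (-|t|) |t|).norm_image_sub_le_of_norm_hasDerivWithin_le
    (C := 2 * √(|t| * δ * N * (2 * M)) + |t| * δ * N + |t| * δ * (2 * √(N * M) + N))
    (fun s _ => ((hasDerivAt_heisenberg_sinOp V₁ k ψ s).sub
      (hasDerivAt_heisenberg_sinOp V₂ k ψ s)).hasDerivWithinAt) (fun s hs => ?_)
    (x := 0) (y := t) ⟨by simp, by simp⟩ ⟨neg_abs_le t, le_abs_self t⟩
  · simpa only [Pi.sub_apply, neg_zero, (schrodingerGroup_spec V₁).map_zero_apply,
      (schrodingerGroup_spec V₂).map_zero_apply, sub_zero, sub_self, Real.norm_eq_abs] using h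
  · refine (norm_heisenberg_velocity_sub_le hk hk1 h₁ h₂ ψ s hN hM hδ).trans ?_
    have hst : |s| ≤ |t| := abs_le.2 hs
    have hN0 : 0 ≤ N := hN ▸ norm_nonneg _
    have hδ0 : 0 ≤ δ := hδ ▸ norm_nonneg _
    have hR0 : 0 ≤ R := (norm_nonneg _).trans h₁
    have hM0 : 0 ≤ M := hM ▸ by positivity
    gcongr

theorem schrodingerGroup_mem_position_domain (V : LInfty) {ψ : L2}
    (hψ : ψ ∈ freeHamiltonian.domain) (hψX : ψ ∈ position.domain) (t : ℝ) :
    schrodingerGroup V t ψ ∈ position.domain := by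
  refine mem_position_domain_of_norm_sinOp_le (C := ‖position ⟨ψ, hψX⟩‖ +
    (2 * √(‖ψ‖ * (‖freeHamiltonian ⟨ψ, hψ⟩‖ + 2 * ‖V‖ * ‖ψ‖)) + ‖ψ‖) * |t|) fun n => ?_
  have hk1 : |((n : ℝ) + 1)⁻¹| ≤ 1 := by
    rw [abs_of_nonneg (by positivity)]
    exact inv_le_one_of_one_le₀ (by linarith [n.cast_nonneg (α := ℝ)])
  exact (norm_sinOp_schrodingerGroup_le (by positivity) hk1 V ⟨ψ, hψ⟩ t).trans
    (add_le_add_left (norm_sinOp_le _ ⟨ψ, hψX⟩) _)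

/-- The bound on the regularized difference survives the limit `k → 0`: it consists of a term of
order `|t|^{3/2} δ^{1/2}` and terms of order `t² δ`. -/
theorem norm_heisenbergPosition_sub_le {R : ℝ} {V₁ V₂ : LInfty} (hV₁ : ‖V₁‖ ≤ R) (hV₂ : ‖V₂‖ ≤ R)
    (ψ : freeHamiltonian.domain) (t : ℝ)
    (h₁ : (ψ : L2) ∈ (heisenbergPosition V₁ t).domain)
    (h₂ : (ψ : L2) ∈ (heisenbergPosition V₂ t).domain)
    {N M δ : ℝ} (hN : N = ‖(ψ : L2)‖) (hM : M = ‖freeHamiltonian ψ‖ + 2 * R * ‖(ψ : L2)‖)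
    (hδ : δ = ‖V₁ - V₂‖) :
    ‖heisenbergPosition V₁ t ⟨ψ, h₁⟩ - heisenbergPosition V₂ t ⟨ψ, h₂⟩‖ ≤
      (2 * √(|t| * δ * N * (2 * M)) + |t| * δ * N + |t| * δ * (2 * √(N * M) + N)) * |t| := by
  rw [heisenbergPosition_apply, heisenbergPosition_apply]
  refine le_of_tendsto ((((schrodingerGroup V₁ (-t)).continuous.tendsto _).comp
    (tendsto_sinOp ⟨_, h₁⟩)).sub (((schrodingerGroup V₂ (-t)).continuous.tendsto _).comp
    (tendsto_sinOp ⟨_, h₂⟩))).norm (Eventually.of_forall fun n => ?_)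
  have hk1 : |((n : ℝ) + 1)⁻¹| ≤ 1 := by
    rw [abs_of_nonneg (by positivity)]
    exact inv_le_one_of_one_le₀ (by linarith [n.cast_nonneg (α := ℝ)])
  exact norm_heisenberg_sinOp_sub_le (by positivity) hk1 hV₁ hV₂ ψ t hN hM hδ

end Schrodinger

theorem lemma4p2 (R : ℝ) (hR : 0 < R) (ψ : Schrodinger.L2)
    (hψ : ψ ∈ Schrodinger.sobolevH2) (hψX : ψ ∈ Schrodinger.positionSq.domain) :
    ∃ Γ : ℝ, ∀ V₁ V₂ : Schrodinger.LInfty, ‖V₁‖ ≤ R → ‖V₂‖ ≤ R → ∀ t : ℝ,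
      ∃ (h₁ : ψ ∈ (Schrodinger.heisenbergPosition V₁ t).domain)
        (h₂ : ψ ∈ (Schrodinger.heisenbergPosition V₂ t).domain),
        ‖Schrodinger.heisenbergPosition V₁ t ⟨ψ, h₁⟩ -
            Schrodinger.heisenbergPosition V₂ t ⟨ψ, h₂⟩‖ ≤
          Γ * (|t| ^ (1 / 2 : ℝ) + t ^ 2) * ‖V₁ - V₂‖ ^ (1 / 2 : ℝ) := by
  obtain ⟨N, hN⟩ : ∃ N, N = ‖ψ‖ := ⟨_, rfl⟩
  obtain ⟨M, hM⟩ : ∃ M, M = ‖Schrodinger.freeHamiltonian ⟨ψ, hψ⟩‖ + 2 * R * ‖ψ‖ := ⟨_, rfl⟩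
  have hN0 : 0 ≤ N := hN ▸ norm_nonneg _
  have hM0 : 0 ≤ M := hM ▸ by positivity
  refine ⟨2 * √(N * (2 * M)) + √(2 * R) * (2 * N + 2 * √(N * M)),
    fun V₁ V₂ hV₁ hV₂ t => ?_⟩
  have hX := Schrodinger.positionSq_domain_le hψX
  have h₁ := Schrodinger.schrodingerGroup_mem_position_domain V₁ hψ hX t
  have h₂ := Schrodinger.schrodingerGroup_mem_position_domain V₂ hψ hX t
  refine ⟨h₁, h₂, ?_⟩
  obtain ⟨δ, hδ⟩ : ∃ δ, δ = ‖V₁ - V₂‖ := ⟨_, rfl⟩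
  refine (Schrodinger.norm_heisenbergPosition_sub_le hV₁ hV₂ ⟨ψ, hψ⟩ t h₁ h₂ hN hM hδ).trans ?_
  rw [← hδ, ← Real.sqrt_eq_rpow, ← Real.sqrt_eq_rpow]
  have hδ0 : 0 ≤ δ := hδ ▸ norm_nonneg _
  have hδR : δ ≤ 2 * R := by
    have := norm_sub_le V₁ V₂
    linarith
  -- Since `δ ≤ 2R`, a full power of `δ` costs only `√(2R)` more than its square root.
  have hδs : δ ≤ √(2 * R) * √δ := by
    calc δ = √δ * √δ := (Real.mul_self_sqrt hδ0).symm
      _ ≤ √(2 * R) * √δ := by gcongr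
  obtain ⟨r, hr⟩ : ∃ r, r = √|t| := ⟨_, rfl⟩
  have hr0 : 0 ≤ r := hr ▸ Real.sqrt_nonneg _
  have hrt : |t| = r ^ 2 := by rw [hr, Real.sq_sqrt (abs_nonneg t)]
  have ht2 : t ^ 2 = r ^ 4 := by rw [← sq_abs, hrt]; ring
  have hs : √(|t| * δ * N * (2 * M)) = r * √δ * √(N * (2 * M)) := by
    rw [mul_assoc (|t| * δ), Real.sqrt_mul (by positivity), Real.sqrt_mul (abs_nonneg t), hr]
  -- `|t|^{3/2} ≤ |t|^{1/2} + t²`, written in terms of `r = |t|^{1/2}`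
  have hr3 : r ^ 3 ≤ r + r ^ 4 := by
    nlinarith [mul_nonneg hr0 (sq_nonneg (r - 1)), mul_nonneg hr0 (sq_nonneg (r ^ 2 - r)),
      mul_nonneg hr0 (mul_nonneg hr0 (sq_nonneg (r - 1)))]
  rw [hs, ← hr, ht2, hrt]
  have hA : 0 ≤ 2 * √(N * (2 * M)) := by positivity
  have hB : 0 ≤ 2 * N + 2 * √(N * M) := by positivity
  calc (2 * (r * √δ * √(N * (2 * M))) + r ^ 2 * δ * N + r ^ 2 * δ * (2 * √(N * M) + N)) * r ^ 2
      = 2 * √(N * (2 * M)) * r ^ 3 * √δ + (2 * N + 2 * √(N * M)) * r ^ 4 * δ := by ring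
    _ ≤ 2 * √(N * (2 * M)) * (r + r ^ 4) * √δ +
        (2 * N + 2 * √(N * M)) * (r + r ^ 4) * (√(2 * R) * √δ) := by
      gcongr
      linarith
    _ = _ := by ring
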